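/- Let $M\ge 1$, let $p>2M$ be real, and let $\Omega\subset\mathbb R^{2M}$ be a bounded connected open set satisfying the cone condition (every point of $\Omega$ is the vertex of a finite cone contained in $\Omega$ and congruent to one fixed finite cone). Write $S^1_p(\Omega)$ for the set of $C^1$ functions on $\Omega$ that belong, together with their gradient, to $L^p(\Omega)$, and for $H,K\in S^1_p(\Omega)$ put $L_{H,K}(u)=\bigl\|\tfrac{\partial H}{\partial u}(u)-\tfrac{\partial K}{\partial u}(u)\bigr\|_p^p=\sum_i|\partial_iH(u)-\partial_iK(u)|^p$. For a bounded set $V\subset\mathbb R^n$ let $\mathcal R_n(V)=\frac1n\,\mathbb E_\sigma\sup_{v\in V}\sum_{i=1}^n\sigma_iv_i$ with $\sigma$ uniform on $\{-1,1\}^n$. There are constants $c_{\mathrm p},C>0$ depending only on $M$, $p$ and $\Omega$ such that the following hold. (i) (Zero-mean Poincaré and Sobolev inequalities.) If $H,K\in S^1_p(\Omega)$ and $\int_\Omega H\,du=\int_\Omega K\,du$, then $L_{H,K}$ and $|H-K|^p$ are integrable on $\Omega$, $H-K$ is bounded on $\Omega$, and $$\int_\Omega|H-K|^p\,du\le c_{\mathrm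 p}\int_\Omega L_{H,K}\,du,\qquad \Bigl(\sup_\Omega|H-K|\Bigr)^p\le C^p\int_\Omega L_{H,K}\,du .$$ (ii) ($L^\infty$ estimate on the Hamiltonian error.) Let $H\in S^1_p(\Omega)$ be the target Hamiltonian, let $\mathcal F\subset S^1_p(\Omega)$ be any hypothesis class (for instance a class of neural networks), and suppose that $L_{H,H_{\mathrm{NN}}}(u)\le c$ for all $H_{\mathrm{NN}}\in\mathcal F$ and $u\in\Omega$. Let $P$ be a probability measure on $\Omega$ with a density $f_P$ with respect to Lebesgue measure such that $\inf_\Omega f_P>0$, and let $n\ge1$, $\delta>0$. Then, with probability at least $1-\delta$ over a $P^n$-distributed sample $(u_1,\dots,u_n)$, the following holds simultaneously for all $H_{\mathrm{NN}}\in\mathcal F$ (in particular for the trained one): if $H$ is shifted by the additive constant for which $\int_\Omega H\,du=\int_\Omega H_{\mathrm{NN}}\,du$, then $$\Bigl(\sup_{u\in\Omega}|H(u)-H_{\mathrm{NN}}(u)|\Bigr)^p\le\frac{C^p}{\inf_\Omega f_P}\left(\frac1n\sum_{j=1}^nL_{H,H_{\mathrm{NN}}}(u_j)+2\,\mathcal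 R_n(\mathcal G)+3c\sqrt{\frac{2\ln(4/\delta)}{n}}\right),$$ where $\mathcal G=\{(L_{H,K}(u_1),\dots,L_{H,K}(u_n)):K\in\mathcal F\}\subset\mathbb R^n$. -/

import Mathlib

open MeasureTheory

noncomputable section

/-- The Euclidean space `ℝ^{2M}` in which the phase space lies. -/
abbrev PhaseVec (M : ℕ) : Type := EuclideanSpace ℝ (Fin (2 * M))

/-- The closed finite cone with vertex `x`, axis direction `v` (a unit vector), height `ρ` and
half-opening angle `θ`: the points `y` with `|y - x| ≤ ρ` whose direction from `x` makes an angle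
at most `θ` with `v` (together with `x` itself). -/
def finiteCone {M : ℕ} (x v : PhaseVec M) (ρ θ : ℝ) : Set (PhaseVec M) :=
  {y | ‖y - x‖ ≤ ρ ∧ ‖y - x‖ * Real.cos θ ≤ inner ℝ v (y - x)}

/-- The cone condition: every point of `Ω` is the vertex of a finite cone contained in `Ω` and
congruent to one fixed finite cone. -/
def ConeCondition {M : ℕ} (Ω : Set (PhaseVec M)) : Prop :=
  ∃ ρ θ : ℝ, 0 < ρ ∧ 0 < θ ∧ θ ≤ Real.pi / 2 ∧
    ∀ x ∈ Ω, ∃ v : PhaseVec M, ‖v‖ = 1 ∧ finiteCone x v ρ θ ⊆ Ω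

/-- Membership in `S^1_p(Ω)`: continuously differentiable functions on the open set `Ω` such that
the function and its gradient belong to `L^p(Ω)`. -/
structure MemS1p {M : ℕ} (p : ℝ) (Ω : Set (PhaseVec M)) (H : PhaseVec M → ℝ) : Prop where
  contDiffOn : ContDiffOn ℝ 1 H Ω
  memLp : MemLp H (ENNReal.ofReal p) (volume.restrict Ω)
  memLp_gradient : MemLp (gradient H) (ENNReal.ofReal p) (volume.restrict Ω)

/-- The `p`-norm gradient loss `‖∂H/∂u (u) - ∂K/∂u (u)‖_p^p = ∑ᵢ |∂ᵢH(u) - ∂ᵢK(u)|^p`. -/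
def gradLoss {M : ℕ} (p : ℝ) (H K : PhaseVec M → ℝ) (u : PhaseVec M) : ℝ :=
  ∑ i, |gradient H u i - gradient K u i| ^ p

/-- The Rademacher complexity `(1/n) E_σ sup_{v ∈ V} ∑ᵢ σᵢ vᵢ` of a bounded set `V ⊆ ℝⁿ`, with `σ`
uniformly distributed on `{-1, 1}ⁿ`. -/
def rademacherComplexity {n : ℕ} (V : Set (Fin n → ℝ)) : ℝ :=
  (1 / (n : ℝ)) * ((1 / (2 : ℝ) ^ n) *
    ∑ σ : Fin n → ℤˣ, sSup ((fun v : Fin n → ℝ => ∑ i, ((σ i : ℤ) : ℝ) * v i) '' V))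

/-- The empirical loss `(1/n) ∑ⱼ ‖∂H/∂u (uⱼ) - ∂K/∂u (uⱼ)‖_p^p` on the sample `u₁, …, uₙ`. -/
def empiricalLoss {M n : ℕ} (p : ℝ) (H K : PhaseVec M → ℝ) (u : Fin n → PhaseVec M) : ℝ :=
  (1 / (n : ℝ)) * ∑ j, gradLoss p H K (u j)

/-- The set `𝒢 ⊆ ℝⁿ` of the vectors of losses on the sample `u₁, …, uₙ` of all hypotheses. -/
def lossClass {M n : ℕ} (p : ℝ) (H : PhaseVec M → ℝ) (F : Set (PhaseVec M → ℝ))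
    (u : Fin n → PhaseVec M) : Set (Fin n → ℝ) :=
  {v | ∃ K ∈ F, v = fun j => gradLoss p H K (u j)}

/-- `sup_{u ∈ Ω} |H(u) - K(u)|`; a junk value unless the set is bounded. -/
def supError {M : ℕ} (Ω : Set (PhaseVec M)) (H K : PhaseVec M → ℝ) : ℝ :=
  sSup ((fun u => |H u - K u|) '' Ω)

end

/-!
The theorem combines a deterministic and a probabilistic estimate.

The deterministic one is Morrey's inequality for `p > d = 2M`. If a ball `B` is visible from `x`
inside `Ω`, then `φ y - φ x` for `y ∈ B` is an integral of `Dφ` along the segment from `x` to `y`.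
Integrating over `y` and exchanging the integrals, the derivative at parameter `t` is integrated
over the image of `B` under a homothety of ratio `t`; Hölder's inequality and the scaling of
Lebesgue measure bound this by `t ^ (-d / p)` times the seminorm `‖Dφ‖_p`, and `t ^ (-d / p)` is
integrable on `(0, 1]` (`lintegral_enorm_sub_le_sobolevSeminorm`). The cone condition makes a ball
of fixed radius visible from every point (`ConeCondition.exists_visible_ball`). The centres of these
balls are totally bounded, so finitely many of them represent all others, and connectedness compares
these finitely many points. Hence the oscillation of `φ` over `Ω` is at most a multiple of `‖Dφ‖_p`
(`exists_enorm_sub_le_sobolevSeminorm`). For `φ = H - K` of mean zero the oscillation dominates the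
supremum, and the Poincaré inequality follows because `Ω` has finite measure.

The probabilistic estimate bounds all expected losses at once by empirical ones. The quantity
`sup_K (E L_K - (1/n) ∑ⱼ L_K(uⱼ)) - 2 R_n` has nonpositive mean by symmetrization
(`integral_uniformDeviation_le`), and changing one sample point changes it by at most `3c / n`, so a
bounded differences inequality controls its upper tail
(`measureReal_ge_le_of_boundedDifferences`). The suprema are taken over arbitrary families; they are
measurable because a supremum of continuous functions is lower semicontinuous. Finally a lower bound
for the density compares the integral of the loss over `Ω` with its expectation
(`sInf_mul_setIntegral_le_integral`).
-/

/-! ### Morrey's inequality -/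

section Morrey

open Module Set

theorem enorm_sub_le_mul_lintegral_fderiv {E : Type*} [NormedAddCommGroup E] [NormedSpace ℝ E]
    {Ω : Set E} (hΩ : IsOpen Ω) {φ : E → ℝ}
    (hφ : ContDiffOn ℝ 1 φ Ω) {x y : E} (hxy : segment ℝ x y ⊆ Ω) :
    ‖φ y - φ x‖ₑ ≤ ‖y - x‖ₑ * ∫⁻ t in Ioc (0 : ℝ) 1, ‖fderiv ℝ φ (x + t • (y - x))‖ₑ := by
  have hmem : ∀ t ∈ Icc (0 : ℝ) 1, x + t • (y - x) ∈ Ω := fun t ht => by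
    apply hxy
    rw [segment_eq_image']
    exact ⟨t, ht, rfl⟩
  have hderiv : ∀ t ∈ uIcc (0 : ℝ) 1, HasDerivAt (fun s : ℝ => φ (x + s • (y - x)))
      (fderiv ℝ φ (x + t • (y - x)) (y - x)) t := fun t ht => by
    rw [uIcc_of_le zero_le_one] at ht
    have h1 : HasFDerivAt φ (fderiv ℝ φ (x + t • (y - x))) (x + t • (y - x)) :=
      ((hφ.contDiffAt (hΩ.mem_nhds (hmem t ht))).differentiableAt one_ne_zero).hasFDerivAt
    have h2 : HasDerivAt (fun s : ℝ => x + s • (y - x)) (y - x) t := by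
      simpa using ((hasDerivAt_id t).smul_const (y - x)).const_add x
    exact h1.comp_hasDerivAt t h2
  have hcont : ContinuousOn (fun t : ℝ => fderiv ℝ φ (x + t • (y - x)) (y - x)) (uIcc 0 1) := by
    rw [uIcc_of_le zero_le_one]
    have h1 : ContinuousOn (fun t : ℝ => fderiv ℝ φ (x + t • (y - x))) (Icc 0 1) :=
      (hφ.continuousOn_fderiv_of_isOpen hΩ le_rfl).comp (by fun_prop) hmem
    exact h1.clm_apply continuousOn_const
  have hint := intervalIntegral.integral_eq_sub_of_hasDerivAt hderiv hcont.intervalIntegrable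
  simp only [one_smul, add_sub_cancel, zero_smul, add_zero] at hint
  rw [← hint, intervalIntegral.integral_of_le zero_le_one]
  calc _ ≤ ∫⁻ t in Ioc (0 : ℝ) 1, ‖fderiv ℝ φ (x + t • (y - x)) (y - x)‖ₑ :=
        enorm_integral_le_lintegral_enorm _
    _ ≤ ∫⁻ t in Ioc (0 : ℝ) 1, ‖y - x‖ₑ * ‖fderiv ℝ φ (x + t • (y - x))‖ₑ := by
        refine lintegral_mono fun t => ?_
        rw [mul_comm]
        exact ContinuousLinearMap.le_opENorm _ _
    _ = _ := lintegral_const_mul' _ _ enorm_ne_top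

variable {E : Type*} [NormedAddCommGroup E] [NormedSpace ℝ E] [FiniteDimensional ℝ E]
  [MeasurableSpace E] [BorelSpace E]

/-- The homogeneous Sobolev seminorm `‖Dφ‖_{L^p(Ω)}`, as an extended nonnegative number, with the
operator norm on the derivative. -/
noncomputable def sobolevSeminorm (p : ℝ) (Ω : Set E) (μ : Measure E) (φ : E → ℝ) : ENNReal :=
  (∫⁻ u in Ω, ‖fderiv ℝ φ u‖ₑ ^ p ∂μ) ^ (1 / p)

theorem lintegral_comp_homothety (μ : Measure E) [μ.IsAddHaarMeasure] (x : E) {t : ℝ} (ht : 0 < t)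
    {F : E → ENNReal} (hF : Measurable F) :
    ∫⁻ y, F (x + t • (y - x)) ∂μ = ENNReal.ofReal ((t ^ finrank ℝ E)⁻¹) * ∫⁻ u, F u ∂μ := by
  calc ∫⁻ y, F (x + t • (y - x)) ∂μ
      = ∫⁻ y, F (x + t • y) ∂μ := by
        simpa only [sub_eq_add_neg] using
          lintegral_add_right_eq_self (μ := μ) (fun y => F (x + t • y)) (-x)
    _ = ∫⁻ u, F (x + u) ∂(μ.map fun y => t • y) :=
        (lintegral_map (hF.comp (measurable_const_add x)) (measurable_const_smul t)).symm
    _ = ENNReal.ofReal ((t ^ finrank ℝ E)⁻¹) * ∫⁻ u, F (x + u) ∂μ := by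
        rw [Measure.map_addHaar_smul μ ht.ne', lintegral_smul_measure, abs_of_pos (by positivity),
          smul_eq_mul]
    _ = _ := by rw [lintegral_add_left_eq_self]

theorem lintegral_le_rpow_mul_lintegral_rpow {α : Type*} [MeasurableSpace α] (μ : Measure α)
    {p : ℝ} (hp : 1 < p) {F : α → ENNReal} (hF : AEMeasurable F μ) :
    ∫⁻ y, F y ∂μ ≤ μ univ ^ (1 - 1 / p) * (∫⁻ y, F y ^ p ∂μ) ^ (1 / p) := by
  have hpq := Real.HolderConjugate.conjExponent hp
  have h := ENNReal.lintegral_mul_le_Lp_mul_Lq μ hpq hF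
    (aemeasurable_const (b := (1 : ENNReal)))
  have h2 : 1 / p.conjExponent = 1 - 1 / p := by
    rw [one_div, one_div, eq_sub_iff_add_eq, add_comm]
    exact hpq.inv_add_inv_eq_one
  simpa [h2, mul_comm] using h

/-- Morrey's estimate in integrated form. Along the segments from `x` to the points of `B`, the
derivative at parameter `t` is integrated over the set `B` shrunk towards `x` by the factor `t`, so
Hölder's inequality produces the factor `t ^ (-d / p)`, which is integrable because `p > d`. -/
theorem lintegral_enorm_sub_le_sobolevSeminorm (μ : Measure E) [μ.IsAddHaarMeasure] {p : ℝ}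
    (hp1 : 1 < p) {Ω : Set E} (hΩ : IsOpen Ω) {φ : E → ℝ}
    (hφ : ContDiffOn ℝ 1 φ Ω) {x : E} {B : Set E} (hB : MeasurableSet B) {R : NNReal}
    (hR : ∀ y ∈ B, ‖y - x‖ₑ ≤ R) (hseg : ∀ y ∈ B, segment ℝ x y ⊆ Ω) :
    ∫⁻ y in B, ‖φ y - φ x‖ₑ ∂μ ≤
      R * (μ B ^ (1 - 1 / p) *
        ∫⁻ t in Ioc (0 : ℝ) 1, ENNReal.ofReal (t ^ (-(finrank ℝ E / p)))) *
        sobolevSeminorm p Ω μ φ := by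
  have hp0 : 0 < p := zero_lt_one.trans hp1
  have hmeas : Measurable fun u => ‖fderiv ℝ φ u‖ₑ := (measurable_fderiv ℝ φ).enorm
  have hinner : ∀ t ∈ Ioc (0 : ℝ) 1, ∫⁻ y in B, ‖fderiv ℝ φ (x + t • (y - x))‖ₑ ∂μ ≤
      μ B ^ (1 - 1 / p) * sobolevSeminorm p Ω μ φ *
        ENNReal.ofReal (t ^ (-(finrank ℝ E / p))) := by
    intro t ht
    have hcomp : Measurable fun y : E => ‖fderiv ℝ φ (x + t • (y - x))‖ₑ :=
      hmeas.comp (by fun_prop)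
    have hscale : ∫⁻ y in B, ‖fderiv ℝ φ (x + t • (y - x))‖ₑ ^ p ∂μ ≤
        ENNReal.ofReal ((t ^ finrank ℝ E)⁻¹) * ∫⁻ u in Ω, ‖fderiv ℝ φ u‖ₑ ^ p ∂μ := by
      rw [← lintegral_indicator hΩ.measurableSet,
        ← lintegral_comp_homothety μ x ht.1 ((hmeas.pow_const p).indicator hΩ.measurableSet),
        ← lintegral_indicator hB]
      refine lintegral_mono fun y => ?_
      by_cases hy : y ∈ B
      · have : x + t • (y - x) ∈ Ω := by
          apply hseg y hy
          rw [segment_eq_image']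
          exact ⟨t, ⟨ht.1.le, ht.2⟩, rfl⟩
        simp [hy, this]
      · simp [hy]
    calc _ ≤ (μ.restrict B) univ ^ (1 - 1 / p) *
          (∫⁻ y in B, ‖fderiv ℝ φ (x + t • (y - x))‖ₑ ^ p ∂μ) ^ (1 / p) :=
          lintegral_le_rpow_mul_lintegral_rpow _ hp1 hcomp.aemeasurable
      _ ≤ μ B ^ (1 - 1 / p) * (ENNReal.ofReal ((t ^ finrank ℝ E)⁻¹) *
            ∫⁻ u in Ω, ‖fderiv ℝ φ u‖ₑ ^ p ∂μ) ^ (1 / p) := by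
          rw [Measure.restrict_apply_univ]
          gcongr
      _ = _ := by
          have h1 : ENNReal.ofReal ((t ^ finrank ℝ E)⁻¹) ^ (1 / p) =
              ENNReal.ofReal (t ^ (-(finrank ℝ E / p))) := by
            rw [ENNReal.ofReal_rpow_of_nonneg (by have := ht.1; positivity) (by positivity),
              ← Real.rpow_natCast, ← Real.rpow_neg ht.1.le, ← Real.rpow_mul ht.1.le]
            congr 2
            ring
          rw [ENNReal.mul_rpow_of_nonneg _ _ (by positivity), h1, sobolevSeminorm]
          ring
  calc ∫⁻ y in B, ‖φ y - φ x‖ₑ ∂μ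
      ≤ ∫⁻ y in B, (R * ∫⁻ t in Ioc (0 : ℝ) 1, ‖fderiv ℝ φ (x + t • (y - x))‖ₑ) ∂μ := by
        refine setLIntegral_mono' hB fun y hy => ?_
        refine (enorm_sub_le_mul_lintegral_fderiv hΩ hφ (hseg y hy)).trans ?_
        gcongr
        exact hR y hy
    _ = R * ∫⁻ t in Ioc (0 : ℝ) 1, ∫⁻ y in B, ‖fderiv ℝ φ (x + t • (y - x))‖ₑ ∂μ := by
        rw [lintegral_const_mul' _ _ ENNReal.coe_ne_top, lintegral_lintegral_swap]
        refine Measurable.aemeasurable ?_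
        exact hmeas.comp (g := fun u => ‖fderiv ℝ φ u‖ₑ)
          (f := fun q : E × ℝ => x + q.2 • (q.1 - x)) (by fun_prop)
    _ ≤ R * ∫⁻ t in Ioc (0 : ℝ) 1, μ B ^ (1 - 1 / p) * sobolevSeminorm p Ω μ φ *
          ENNReal.ofReal (t ^ (-(finrank ℝ E / p))) := by
        gcongr 1
        exact setLIntegral_mono' measurableSet_Ioc hinner
    _ = _ := by
        rw [lintegral_const_mul _ (by fun_prop)]
        ring

theorem lintegral_Ioc_rpow_neg_lt_top {s : ℝ} (hs : s < 1) :
    ∫⁻ t in Ioc (0 : ℝ) 1, ENNReal.ofReal (t ^ (-s)) < ⊤ := by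
  have h := (intervalIntegral.intervalIntegrable_rpow' (a := 0) (b := 1) (r := -s) (by linarith)).1
  exact h.lintegral_lt_top

/-- Morrey's inequality: two points from which a common ball is visible inside `Ω` have values that
differ by a multiple of the seminorm; the multiple depends only on the two radii. -/
theorem exists_enorm_sub_le_sobolevSeminorm_of_ball (μ : Measure E) [μ.IsAddHaarMeasure] {p : ℝ}
    (hp1 : 1 < p) (hp : finrank ℝ E < p) (R : NNReal) {r : ℝ} (hr : 0 < r) :
    ∃ C : NNReal, ∀ Ω : Set E, IsOpen Ω → ∀ x z w : E,
      (∀ y ∈ Metric.ball w r, ‖y - x‖ₑ ≤ R ∧ segment ℝ x y ⊆ Ω) →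
      (∀ y ∈ Metric.ball w r, ‖y - z‖ₑ ≤ R ∧ segment ℝ z y ⊆ Ω) →
      ∀ φ : E → ℝ, ContDiffOn ℝ 1 φ Ω → ‖φ x - φ z‖ₑ ≤ C * sobolevSeminorm p Ω μ φ := by
  have hp0 : 0 < p := zero_lt_one.trans hp1
  set I : ENNReal := ∫⁻ t in Ioc (0 : ℝ) 1, ENNReal.ofReal (t ^ (-(finrank ℝ E / p))) with hI
  have hIfin : I ≠ ⊤ := (lintegral_Ioc_rpow_neg_lt_top ((div_lt_one hp0).2 hp)).ne
  set v : ENNReal := μ (Metric.ball 0 r) with hv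
  have hv0 : v ≠ 0 := (Metric.measure_ball_pos μ 0 hr).ne'
  have hvfin : v ≠ ⊤ := Metric.isBounded_ball.measure_lt_top.ne
  set D : ENNReal := R * (v ^ (1 - 1 / p) * I) with hD
  have hexp : 0 ≤ 1 - 1 / p := by
    rw [sub_nonneg, div_le_one hp0]
    exact hp1.le
  have hDfin : D ≠ ⊤ := ENNReal.mul_ne_top ENNReal.coe_ne_top
    (ENNReal.mul_ne_top (ENNReal.rpow_ne_top_of_nonneg hexp hvfin) hIfin)
  have hCfin : v⁻¹ * (D + D) ≠ ⊤ :=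
    ENNReal.mul_ne_top (ENNReal.inv_ne_top.2 hv0) (ENNReal.add_ne_top.2 ⟨hDfin, hDfin⟩)
  refine ⟨(v⁻¹ * (D + D)).toNNReal, fun Ω hΩ x z w hx hz φ hφ => ?_⟩
  rw [ENNReal.coe_toNNReal hCfin]
  have hball : MeasurableSet (Metric.ball w r) := Metric.isOpen_ball.measurableSet
  have hvw : μ (Metric.ball w r) = v := Measure.addHaar_ball_center μ w r
  have h1 := lintegral_enorm_sub_le_sobolevSeminorm μ hp1 hΩ hφ hball
    (fun y hy => (hx y hy).1) (fun y hy => (hx y hy).2)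
  have h2 := lintegral_enorm_sub_le_sobolevSeminorm μ hp1 hΩ hφ hball
    (fun y hy => (hz y hy).1) (fun y hy => (hz y hy).2)
  rw [hvw] at h1 h2
  have hmeas : AEMeasurable (fun y => ‖φ y - φ x‖ₑ) (μ.restrict (Metric.ball w r)) := by
    refine ContinuousOn.aemeasurable (f := fun y => ‖φ y - φ x‖ₑ) ?_ hball
    have : ContinuousOn φ (Metric.ball w r) :=
      hφ.continuousOn.mono fun y hy => (hx y hy).2 (right_mem_segment ℝ x y)
    exact (this.sub continuousOn_const).enorm
  have h3 : v * ‖φ x - φ z‖ₑ ≤ (D + D) * sobolevSeminorm p Ω μ φ := by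
    calc v * ‖φ x - φ z‖ₑ = ∫⁻ _ in Metric.ball w r, ‖φ x - φ z‖ₑ ∂μ := by
          rw [setLIntegral_const, hvw, mul_comm]
      _ ≤ ∫⁻ y in Metric.ball w r, (‖φ y - φ x‖ₑ + ‖φ y - φ z‖ₑ) ∂μ := by
          refine lintegral_mono fun y => ?_
          have : φ x - φ z = -(φ y - φ x) + (φ y - φ z) := by ring
          rw [this]
          refine (enorm_add_le _ _).trans ?_
          rw [enorm_neg]
      _ = _ := lintegral_add_left' hmeas _
      _ ≤ D * sobolevSeminorm p Ω μ φ + D * sobolevSeminorm p Ω μ φ := add_le_add h1 h2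
      _ = _ := by ring
  calc ‖φ x - φ z‖ₑ = v⁻¹ * (v * ‖φ x - φ z‖ₑ) := by
        rw [← mul_assoc, ENNReal.inv_mul_cancel hv0 hvfin, one_mul]
    _ ≤ v⁻¹ * ((D + D) * sobolevSeminorm p Ω μ φ) := by gcongr
    _ = _ := by ring

/-! ### Oscillation on connected domains -/

/-- On a connected open set any two values differ by a multiple of the seminorm; here the multiple
may depend on the two points. -/
theorem exists_enorm_sub_le_sobolevSeminorm_of_isPreconnected (μ : Measure E)
    [μ.IsAddHaarMeasure] {p : ℝ} (hp1 : 1 < p) (hp : finrank ℝ E < p) {Ω : Set E}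
    (hΩ : IsOpen Ω) (hconn : IsPreconnected Ω) {x z : E} (hx : x ∈ Ω) (hz : z ∈ Ω) :
    ∃ C : NNReal, ∀ φ : E → ℝ, ContDiffOn ℝ 1 φ Ω →
      ‖φ x - φ z‖ₑ ≤ C * sobolevSeminorm p Ω μ φ := by
  refine hconn.induction₂ (fun x z => ∃ C : NNReal, ∀ φ : E → ℝ, ContDiffOn ℝ 1 φ Ω →
      ‖φ x - φ z‖ₑ ≤ C * sobolevSeminorm p Ω μ φ) ?_ ?_ ?_ hx hz
  · intro x hx
    obtain ⟨r, hr, hrΩ⟩ := Metric.isOpen_iff.1 hΩ x hx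
    obtain ⟨C, hC⟩ := exists_enorm_sub_le_sobolevSeminorm_of_ball μ hp1 hp (2 * r).toNNReal hr
    have hvis : ∀ z ∈ Metric.ball x r, ∀ y ∈ Metric.ball x r,
        ‖y - z‖ₑ ≤ (2 * r).toNNReal ∧ segment ℝ z y ⊆ Ω := by
      intro z hz y hy
      refine ⟨?_, ((convex_ball x r).segment_subset hz hy).trans hrΩ⟩
      rw [← ofReal_norm, ← dist_eq_norm]
      refine ENNReal.ofReal_le_ofReal ?_
      have h1 := dist_triangle_right y z x
      rw [Metric.mem_ball] at hz hy
      linarith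
    filter_upwards [mem_nhdsWithin_of_mem_nhds (Metric.ball_mem_nhds x hr)] with z hz
    exact ⟨C, hC Ω hΩ x z x (hvis x (Metric.mem_ball_self hr)) (hvis z hz)⟩
  · rintro x y z - - - ⟨C, hC⟩ ⟨D, hD⟩
    refine ⟨C + D, fun φ hφ => ?_⟩
    have : φ x - φ z = (φ x - φ y) + (φ y - φ z) := by ring
    rw [this, ENNReal.coe_add, add_mul]
    exact (enorm_add_le _ _).trans (add_le_add (hC φ hφ) (hD φ hφ))
  · rintro x y - - ⟨C, hC⟩
    refine ⟨C, fun φ hφ => ?_⟩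
    rw [← enorm_neg, neg_sub]
    exact hC φ hφ

/-- The oscillation over a bounded connected open set is controlled by the seminorm, provided that
from every point a ball of a fixed radius is visible at a bounded distance. The centres of these
balls form a totally bounded set, so finitely many of them suffice up to one more use of Morrey's
inequality, and connectedness compares these finitely many points. -/
theorem exists_enorm_sub_le_sobolevSeminorm (μ : Measure E) [μ.IsAddHaarMeasure] {p : ℝ}
    (hp1 : 1 < p) (hp : finrank ℝ E < p) {Ω : Set E} (hΩ : IsOpen Ω) (hconn : IsConnected Ω)
    (hbdd : Bornology.IsBounded Ω) {r R : ℝ} (hr : 0 < r) (hrR : 2 * r ≤ R)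
    (hvis : ∀ x ∈ Ω, ∃ w : E, ∀ y ∈ Metric.ball w r, ‖y - x‖ ≤ R ∧ segment ℝ x y ⊆ Ω) :
    ∃ C : NNReal, ∀ φ : E → ℝ, ContDiffOn ℝ 1 φ Ω → ∀ x ∈ Ω, ∀ z ∈ Ω,
      ‖φ x - φ z‖ₑ ≤ C * sobolevSeminorm p Ω μ φ := by
  obtain ⟨x₀, hx₀⟩ := hconn.nonempty
  obtain ⟨C, hC⟩ := exists_enorm_sub_le_sobolevSeminorm_of_ball μ hp1 hp R.toNNReal hr
  have hR : ∀ y x : E, ‖y - x‖ ≤ R → ‖y - x‖ₑ ≤ R.toNNReal := fun y x h => by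
    rw [← ofReal_norm]
    exact ENNReal.ofReal_le_ofReal h
  set Z : Set E := {w | Metric.ball w r ⊆ Ω} with hZ
  have hZΩ : Z ⊆ Ω := fun w hw => hw (Metric.mem_ball_self hr)
  have hZtb : TotallyBounded Z :=
    hbdd.isCompact_closure.totallyBounded.subset (hZΩ.trans subset_closure)
  obtain ⟨T, hTZ, hTfin, hT⟩ := Metric.finite_approx_of_totallyBounded hZtb r hr
  have hbase : ∀ w : E, ∃ D : NNReal, w ∈ Ω → ∀ φ : E → ℝ, ContDiffOn ℝ 1 φ Ω →
      ‖φ w - φ x₀‖ₑ ≤ D * sobolevSeminorm p Ω μ φ := fun w => by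
    by_cases hw : w ∈ Ω
    · obtain ⟨D, hD⟩ := exists_enorm_sub_le_sobolevSeminorm_of_isPreconnected μ hp1 hp hΩ
        hconn.isPreconnected hw hx₀
      exact ⟨D, fun _ => hD⟩
    · exact ⟨0, fun h => absurd h hw⟩
  choose D hD using hbase
  have hball : ∀ w ∈ Z, ∀ z ∈ Metric.ball w r, ∀ y ∈ Metric.ball w r,
      ‖y - z‖ₑ ≤ R.toNNReal ∧ segment ℝ z y ⊆ Ω := fun w hw z hz y hy => by
    refine ⟨hR _ _ ?_, ((convex_ball w r).segment_subset hz hy).trans hw⟩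
    rw [← dist_eq_norm]
    have h1 := dist_triangle_right y z w
    rw [Metric.mem_ball] at hz hy
    linarith
  set K : NNReal := C + C + ∑ w ∈ hTfin.toFinset, D w with hK
  have hfrom : ∀ φ : E → ℝ, ContDiffOn ℝ 1 φ Ω → ∀ x ∈ Ω,
      ‖φ x - φ x₀‖ₑ ≤ K * sobolevSeminorm p Ω μ φ := by
    intro φ hφ x hx
    obtain ⟨w, hw⟩ := hvis x hx
    have hwZ : w ∈ Z := fun y hy => (hw y hy).2 (right_mem_segment ℝ x y)
    obtain ⟨w', hw'T, hww'⟩ := mem_iUnion₂.1 (hT hwZ)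
    have hw'Z := hTZ hw'T
    have h1 : ‖φ x - φ w‖ₑ ≤ C * sobolevSeminorm p Ω μ φ :=
      hC Ω hΩ x w w (fun y hy => ⟨hR _ _ (hw y hy).1, (hw y hy).2⟩)
        (hball w hwZ w (Metric.mem_ball_self hr)) φ hφ
    have h2 : ‖φ w - φ w'‖ₑ ≤ C * sobolevSeminorm p Ω μ φ :=
      hC Ω hΩ w w' w' (hball w' hw'Z w hww') (hball w' hw'Z w' (Metric.mem_ball_self hr)) φ hφ
    have h3 : ‖φ w' - φ x₀‖ₑ ≤ D w' * sobolevSeminorm p Ω μ φ := hD w' (hZΩ hw'Z) φ hφ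
    have h4 : D w' ≤ ∑ w ∈ hTfin.toFinset, D w :=
      Finset.single_le_sum (fun _ _ => zero_le) (hTfin.mem_toFinset.2 hw'T)
    have h5 : φ x - φ x₀ = (φ x - φ w) + (φ w - φ w') + (φ w' - φ x₀) := by ring
    calc ‖φ x - φ x₀‖ₑ ≤ ‖φ x - φ w‖ₑ + ‖φ w - φ w'‖ₑ + ‖φ w' - φ x₀‖ₑ := by
          rw [h5]
          exact (enorm_add_le _ _).trans (add_le_add (enorm_add_le _ _) le_rfl)
      _ ≤ C * sobolevSeminorm p Ω μ φ + C * sobolevSeminorm p Ω μ φ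
          + (∑ w ∈ hTfin.toFinset, D w : NNReal) * sobolevSeminorm p Ω μ φ := by
          gcongr
          exact h3.trans (by gcongr)
      _ = K * sobolevSeminorm p Ω μ φ := by
          rw [hK, ENNReal.coe_add, ENNReal.coe_add]
          ring
  refine ⟨K + K, fun φ hφ x hx z hz => ?_⟩
  have h : φ x - φ z = (φ x - φ x₀) + -(φ z - φ x₀) := by ring
  rw [h, ENNReal.coe_add, add_mul]
  refine (enorm_add_le _ _).trans (add_le_add (hfrom φ hφ x hx) ?_)
  rw [enorm_neg]
  exact hfrom φ hφ z hz

end Morrey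

/-! ### Bounded differences -/

section BoundedDifferences

open ProbabilityTheory

variable {X : Type*} [MeasurableSpace X]

/-- Conditioning on all coordinates but one, Hoeffding's lemma bounds the moment generating
function of one increment; an induction over the coordinates does the rest. The constant is not the
optimal one: the values of `f` along one coordinate are only placed in an interval of length
`2 * k`. -/
theorem integral_exp_mul_sub_le_of_boundedDifferences (μ : Measure X) [IsProbabilityMeasure μ]
    {k b : ℝ} (hk : 0 ≤ k) (t : ℝ) : ∀ (n : ℕ) (f : (Fin n → X) → ℝ), Measurable f →
      (∀ u, |f u| ≤ b) → (∀ u i x, |f (Function.update u i x) - f u| ≤ k) →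
      ∫ u, Real.exp (t * (f u - ∫ v, f v ∂Measure.pi fun _ => μ)) ∂(Measure.pi fun _ => μ) ≤
        Real.exp (n * (k ^ 2 * t ^ 2 / 2)) := by
  intro n
  induction n with
  | zero =>
    intro f _ _ _
    have h : ∀ u : Fin 0 → X, f u = f default := fun u => by rw [Subsingleton.elim u default]
    simp [h]
  | succ n ih =>
    intro f hf hb hdiff
    set ν : Measure (Fin n → X) := Measure.pi fun _ => μ with hν
    set e := MeasurableEquiv.piFinSuccAbove (fun _ : Fin (n + 1) => X) 0 with he
    have hmp : MeasurePreserving e (Measure.pi fun _ => μ) (μ.prod ν) :=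
      measurePreserving_piFinSuccAbove (fun _ => μ) 0
    have hesymm : ∀ x v, e.symm (x, v) = Fin.cons x v := fun x v => by
      simp [he, MeasurableEquiv.piFinSuccAbove, Fin.insertNthEquiv]
    have hchange : ∀ G : (Fin (n + 1) → X) → ℝ, ∫ u, G u ∂(Measure.pi fun _ => μ) =
        ∫ q, G (Fin.cons q.1 q.2) ∂(μ.prod ν) := fun G => by
      rw [← hmp.symm.integral_comp' G]
      refine integral_congr_ae (ae_of_all _ fun q => ?_)
      simp only [← hesymm]
    have hcons : Measurable fun q : X × (Fin n → X) => (Fin.cons q.1 q.2 : Fin (n + 1) → X) := by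
      have := e.symm.measurable
      convert this using 2 with q
      exact (hesymm q.1 q.2).symm
    have hfc : Measurable fun q : X × (Fin n → X) => f (Fin.cons q.1 q.2) := hf.comp hcons
    have hbint : ∀ {Y : Type _} [MeasurableSpace Y] (m : Measure Y) [IsFiniteMeasure m]
        (h : Y → ℝ) (c : ℝ), Measurable h → (∀ y, |h y| ≤ c) → Integrable h m :=
      fun m _ h c hm hc => Integrable.of_bound hm.aestronglyMeasurable c (ae_of_all _ hc)
    set g : (Fin n → X) → ℝ := fun v => ∫ x, f (Fin.cons x v) ∂μ with hg
    have hsec : ∀ v, Measurable fun x => f (Fin.cons x v) := fun v =>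
      hfc.comp (measurable_id.prodMk measurable_const)
    have hsecint : ∀ v, Integrable (fun x => f (Fin.cons x v)) μ := fun v =>
      hbint μ _ b (hsec v) fun x => hb _
    have hgm : Measurable g :=
      (hfc.stronglyMeasurable.integral_prod_left (μ := μ)).measurable
    have hgb : ∀ v, |g v| ≤ b := fun v => by
      have := norm_integral_le_of_norm_le_const (μ := μ) (f := fun x => f (Fin.cons x v)) (C := b)
        (ae_of_all _ fun x => hb _)
      simpa using this
    have hgd : ∀ v i x, |g (Function.update v i x) - g v| ≤ k := fun v i x => by
      rw [hg]
      simp only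
      rw [← integral_sub (hsecint _) (hsecint _)]
      have := norm_integral_le_of_norm_le_const (μ := μ)
        (f := fun y => f (Fin.cons y (Function.update v i x)) - f (Fin.cons y v)) (C := k)
        (ae_of_all _ fun y => by
          rw [Fin.cons_update]
          exact hdiff _ _ _)
      simpa using this
    have hmean : ∫ u, f u ∂(Measure.pi fun _ => μ) = ∫ v, g v ∂ν := by
      rw [hchange, integral_prod_symm _ (hbint _ _ b hfc fun q => hb _)]
    have hinner : ∀ v, ∫ x, Real.exp (t * (f (Fin.cons x v) - g v)) ∂μ ≤
        Real.exp (k ^ 2 * t ^ 2 / 2) := by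
      intro v
      have hne : Nonempty X := nonempty_of_isProbabilityMeasure μ
      obtain ⟨x₀⟩ := hne
      have hmem : ∀ x, f (Fin.cons x v) ∈
          Set.Icc (f (Fin.cons x₀ v) - k) (f (Fin.cons x₀ v) + k) := fun x => by
        have h := hdiff (Fin.cons x₀ v) 0 x
        rw [Fin.update_cons_zero, abs_le] at h
        constructor <;> linarith [h.1, h.2]
      have h := (hasSubgaussianMGF_of_mem_Icc (hsec v).aemeasurable
        (ae_of_all μ hmem)).mgf_le t
      rw [mgf] at h
      refine h.trans (le_of_eq ?_)
      congr 1
      have : (‖f (Fin.cons x₀ v) + k - (f (Fin.cons x₀ v) - k)‖₊ : ℝ) = 2 * k := by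
        rw [coe_nnnorm, Real.norm_eq_abs, abs_of_nonneg (by linarith)]
        ring
      push_cast
      rw [← coe_nnnorm, this]
      ring
    set m : ℝ := ∫ v, g v ∂ν with hm
    have hb0 : ∀ y : ℝ, |y| ≤ b → t * (y - m) ≤ |t| * (b + |m|) := fun y hy => by
      refine (le_abs_self _).trans ?_
      rw [abs_mul]
      gcongr
      exact (abs_sub _ _).trans (by linarith)
    have hint : Integrable (fun q : X × (Fin n → X) => Real.exp (t * (f (Fin.cons q.1 q.2) - m)))
        (μ.prod ν) := by
      refine hbint _ _ (Real.exp (|t| * (b + |m|))) (by fun_prop) fun q => ?_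
      rw [abs_of_pos (Real.exp_pos _)]
      exact Real.exp_le_exp.2 (hb0 _ (hb _))
    rw [hmean, hchange, integral_prod_symm _ hint]
    calc ∫ v, ∫ x, Real.exp (t * (f (Fin.cons x v) - m)) ∂μ ∂ν
        ≤ ∫ v, Real.exp (k ^ 2 * t ^ 2 / 2) * Real.exp (t * (g v - m)) ∂ν := by
          refine integral_mono hint.integral_prod_right ?_ fun v => ?_
          · refine Integrable.const_mul ?_ _
            refine hbint _ _ (Real.exp (|t| * (b + |m|))) (by fun_prop) fun v => ?_
            rw [abs_of_pos (Real.exp_pos _)]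
            exact Real.exp_le_exp.2 (hb0 _ (hgb _))
          · have hsplit : ∀ x, Real.exp (t * (f (Fin.cons x v) - m)) =
                Real.exp (t * (f (Fin.cons x v) - g v)) * Real.exp (t * (g v - m)) := fun x => by
              rw [← Real.exp_add]
              ring_nf
            simp only [hsplit]
            rw [integral_mul_const]
            gcongr
            exact hinner v
      _ = Real.exp (k ^ 2 * t ^ 2 / 2) * ∫ v, Real.exp (t * (g v - m)) ∂ν :=
          integral_const_mul _ _
      _ ≤ Real.exp (k ^ 2 * t ^ 2 / 2) * Real.exp (n * (k ^ 2 * t ^ 2 / 2)) := by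
          gcongr
          exact ih g hgm hgb hgd
      _ = _ := by
          rw [← Real.exp_add]
          congr 1
          push_cast
          ring

/-- McDiarmid's inequality, with the constant of the Azuma–Hoeffding inequality. -/
theorem measureReal_ge_le_of_boundedDifferences (μ : Measure X) [IsProbabilityMeasure μ]
    {n : ℕ} {k b ε : ℝ} (hk : 0 < k) (f : (Fin n → X) → ℝ) (hf : Measurable f)
    (hb : ∀ u, |f u| ≤ b) (hdiff : ∀ u i x, |f (Function.update u i x) - f u| ≤ k)
    (hε : 0 ≤ ε) :
    (Measure.pi fun _ : Fin n => μ).real {u | ε ≤ f u - ∫ v, f v ∂Measure.pi fun _ => μ} ≤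
      Real.exp (-ε ^ 2 / (2 * (n * k ^ 2))) := by
  have hsub : HasSubgaussianMGF (fun u => f u - ∫ v, f v ∂Measure.pi fun _ : Fin n => μ)
      (n * (k.toNNReal) ^ 2) (Measure.pi fun _ : Fin n => μ) := by
    constructor
    · intro t
      refine Integrable.of_bound (by fun_prop)
        (Real.exp (|t| * (b + |∫ v, f v ∂Measure.pi fun _ : Fin n => μ|)))
        (ae_of_all _ fun u => ?_)
      rw [Real.norm_eq_abs, abs_of_pos (Real.exp_pos _)]
      refine Real.exp_le_exp.2 ((le_abs_self _).trans ?_)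
      rw [abs_mul]
      gcongr
      exact (abs_sub _ _).trans (by linarith [hb u])
    · intro t
      refine (integral_exp_mul_sub_le_of_boundedDifferences μ hk.le t n f hf hb hdiff).trans
        (le_of_eq ?_)
      congr 1
      push_cast
      rw [Real.coe_toNNReal _ hk.le]
      ring
  have h := hsub.measure_ge_le hε
  push_cast at h
  rwa [Real.coe_toNNReal _ hk.le] at h

end BoundedDifferences

/-! ### Uniform deviation and Rademacher complexity -/

section Rademacher

theorem abs_ciSup_le {ι : Type*} [Nonempty ι] {a : ι → ℝ} {b : ℝ} (h : ∀ i, |a i| ≤ b) :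
    |⨆ i, a i| ≤ b := by
  obtain ⟨i₀⟩ := ‹Nonempty ι›
  rw [abs_le]
  refine ⟨?_, haveI : Nonempty ι := ⟨i₀⟩; ciSup_le fun i => (abs_le.1 (h i)).2⟩
  exact (abs_le.1 (h i₀)).1.trans
    (le_ciSup ⟨b, Set.forall_mem_range.2 fun i => (abs_le.1 (h i)).2⟩ i₀)

theorem abs_ciSup_sub_ciSup_le {ι : Type*} [Nonempty ι] {a a' : ι → ℝ} {k : ℝ}
    (ha : BddAbove (Set.range a)) (ha' : BddAbove (Set.range a')) (h : ∀ i, |a i - a' i| ≤ k) :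
    |(⨆ i, a i) - ⨆ i, a' i| ≤ k := by
  rw [abs_le]
  constructor
  · have : ⨆ i, a' i ≤ (⨆ i, a i) + k := ciSup_le fun i => by
      linarith [le_ciSup ha i, (abs_le.1 (h i)).1]
    linarith
  · have : ⨆ i, a i ≤ (⨆ i, a' i) + k := ciSup_le fun i => by
      linarith [le_ciSup ha' i, (abs_le.1 (h i)).2]
    linarith

/-- Changing one sample point changes a weighted sum only in one term. -/
theorem sum_mul_update_sub {X : Type*} {n : ℕ} (a : Fin n → ℝ) (g : X → ℝ) (u : Fin n → X)
    (k : Fin n) (x : X) :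
    ∑ j, a j * g (Function.update u k x j) - ∑ j, a j * g (u j) = a k * (g x - g (u k)) := by
  rw [← Finset.sum_sub_distrib, Finset.sum_eq_single k]
  · simp [mul_sub]
  · intro j _ hj
    simp [hj]
  · simp

theorem measurable_ciSup_of_continuous {ι Y : Type*} [TopologicalSpace Y] [MeasurableSpace Y]
    [OpensMeasurableSpace Y] {h : ι → Y → ℝ} {b : ℝ} (hc : ∀ i, Continuous (h i))
    (hb : ∀ i y, |h i y| ≤ b) : Measurable fun y => ⨆ i, h i y :=
  (lowerSemicontinuous_ciSup
    (fun y => ⟨b, Set.forall_mem_range.2 fun i => (abs_le.1 (hb i y)).2⟩)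
    fun i => (hc i).lowerSemicontinuous).measurable

theorem abs_units_cast (s : ℤˣ) : |((s : ℤ) : ℝ)| = 1 := by
  rcases Int.units_eq_one_or s with h | h <;> simp [h]

variable {X ι : Type*} {n : ℕ}

/-- The supremum `sup_i ∑ⱼ σⱼ Gᵢ(uⱼ)` of the signed sums of a family of functions over the sample
`u`. -/
noncomputable def signedSup (G : ι → X → ℝ) (σ : Fin n → ℤˣ) (u : Fin n → X) : ℝ :=
  ⨆ i, ∑ j, ((σ j : ℤ) : ℝ) * G i (u j)

theorem rademacherComplexity_range (G : ι → X → ℝ) (u : Fin n → X) :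
    rademacherComplexity (Set.range fun i j => G i (u j)) =
      (1 / (n : ℝ)) * ((1 / (2 : ℝ) ^ n) * ∑ σ : Fin n → ℤˣ, signedSup G σ u) := by
  unfold rademacherComplexity signedSup
  simp only [← Set.range_comp]
  rfl

/-- A uniform bound on the signed suprema, or on their increments, passes to the average over the
signs. -/
theorem abs_rademacherComplexity_le {S : (Fin n → ℤˣ) → ℝ} {b : ℝ} (hS : ∀ σ, |S σ| ≤ b) :
    |(1 / (n : ℝ)) * ((1 / (2 : ℝ) ^ n) * ∑ σ : Fin n → ℤˣ, S σ)| ≤ b / n := by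
  have hcard : (Fintype.card (Fin n → ℤˣ) : ℝ) = 2 ^ n := by simp
  have h : |∑ σ : Fin n → ℤˣ, S σ| ≤ 2 ^ n * b := by
    refine (Finset.abs_sum_le_sum_abs _ _).trans ((Finset.sum_le_sum fun σ _ => hS σ).trans ?_)
    rw [Finset.sum_const, Finset.card_univ, nsmul_eq_mul, hcard]
  rw [abs_mul, abs_mul, abs_of_nonneg (by positivity : 0 ≤ 1 / (n : ℝ)),
    abs_of_nonneg (by positivity : 0 ≤ 1 / (2 : ℝ) ^ n)]
  calc _ ≤ 1 / (n : ℝ) * (1 / 2 ^ n * (2 ^ n * b)) := by gcongr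
    _ = _ := by field_simp

section Bounded

variable {G : ι → X → ℝ} {c : ℝ}

theorem abs_sum_units_mul_le (hG : ∀ i x, G i x ∈ Set.Icc 0 c) (σ : Fin n → ℤˣ)
    (u : Fin n → X) (i : ι) : |∑ j, ((σ j : ℤ) : ℝ) * G i (u j)| ≤ n * c := by
  refine (Finset.abs_sum_le_sum_abs _ _).trans ?_
  calc _ ≤ ∑ _j : Fin n, c := Finset.sum_le_sum fun j _ => by
        rw [abs_mul, abs_units_cast, one_mul, abs_of_nonneg (hG i _).1]
        exact (hG i _).2
    _ = _ := by simp

theorem abs_signedSup_le [Nonempty ι] (hG : ∀ i x, G i x ∈ Set.Icc 0 c) (σ : Fin n → ℤˣ)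
    (u : Fin n → X) :
    |signedSup G σ u| ≤ n * c :=
  abs_ciSup_le fun i => abs_sum_units_mul_le hG σ u i

theorem le_signedSup (hG : ∀ i x, G i x ∈ Set.Icc 0 c) (σ : Fin n → ℤˣ) (u : Fin n → X) (i : ι) :
    ∑ j, ((σ j : ℤ) : ℝ) * G i (u j) ≤ signedSup G σ u :=
  le_ciSup (f := fun i => ∑ j, ((σ j : ℤ) : ℝ) * G i (u j)) ⟨n * c, Set.forall_mem_range.2 fun i =>
    (abs_le.1 (abs_sum_units_mul_le hG σ u i)).2⟩ i

theorem abs_signedSup_update_sub_le [Nonempty ι] (hG : ∀ i x, G i x ∈ Set.Icc 0 c) (σ : Fin n → ℤˣ)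
    (u : Fin n → X) (k : Fin n) (x : X) :
    |signedSup G σ (Function.update u k x) - signedSup G σ u| ≤ c := by
  have hbdd : ∀ v : Fin n → X, BddAbove (Set.range fun i => ∑ j, ((σ j : ℤ) : ℝ) * G i (v j)) :=
    fun v => ⟨n * c, Set.forall_mem_range.2 fun i => (abs_le.1 (abs_sum_units_mul_le hG σ v i)).2⟩
  refine abs_ciSup_sub_ciSup_le (hbdd _) (hbdd _) fun i => ?_
  rw [sum_mul_update_sub (fun j => ((σ j : ℤ) : ℝ)) (G i), abs_mul, abs_units_cast, one_mul, abs_le]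
  constructor <;> linarith [(hG i x).1, (hG i x).2, (hG i (u k)).1, (hG i (u k)).2]

end Bounded

variable [MeasurableSpace X]

/-- The largest excess `sup_i (E Gᵢ - (1/n) ∑ⱼ Gᵢ(uⱼ))` of an expectation over the corresponding
empirical mean. -/
noncomputable def uniformDeviation (μ : Measure X) (G : ι → X → ℝ) (u : Fin n → X) : ℝ :=
  ⨆ i, (∫ x, G i x ∂μ - ∑ j, (1 / (n : ℝ)) * G i (u j))

section Deviation

variable (μ : Measure X) [IsProbabilityMeasure μ] {G : ι → X → ℝ} {c : ℝ}

theorem abs_integral_sub_empirical_le (hG : ∀ i x, G i x ∈ Set.Icc 0 c) (hn : 0 < n)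
    (u : Fin n → X) (i : ι) : |∫ x, G i x ∂μ - ∑ j, (1 / (n : ℝ)) * G i (u j)| ≤ c := by
  have hn' : (0 : ℝ) < n := Nat.cast_pos.2 hn
  have h1 : 0 ≤ ∫ x, G i x ∂μ := integral_nonneg fun x => (hG i x).1
  have h2 : ∫ x, G i x ∂μ ≤ c := by
    have h := norm_integral_le_of_norm_le_const (μ := μ) (f := G i) (C := c)
      (ae_of_all _ fun x => by
        rw [Real.norm_eq_abs, abs_of_nonneg (hG i x).1]
        exact (hG i x).2)
    simpa using (le_abs_self _).trans h
  have h3 : 0 ≤ ∑ j, (1 / (n : ℝ)) * G i (u j) :=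
    Finset.sum_nonneg fun j _ => mul_nonneg (by positivity) (hG i _).1
  have h4 : ∑ j, (1 / (n : ℝ)) * G i (u j) ≤ c := by
    calc _ ≤ ∑ _j : Fin n, (1 / (n : ℝ)) * c := Finset.sum_le_sum fun j _ => by
          gcongr
          exact (hG i _).2
      _ = c := by
          rw [Finset.sum_const, Finset.card_univ, Fintype.card_fin, nsmul_eq_mul]
          field_simp
  rw [abs_le]
  constructor <;> linarith

theorem abs_uniformDeviation_le [Nonempty ι] (hG : ∀ i x, G i x ∈ Set.Icc 0 c) (hn : 0 < n)
    (u : Fin n → X) :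
    |uniformDeviation μ G u| ≤ c :=
  abs_ciSup_le fun i => abs_integral_sub_empirical_le μ hG hn u i

theorem bddAbove_range_integral_sub_empirical (hG : ∀ i x, G i x ∈ Set.Icc 0 c) (hn : 0 < n)
    (u : Fin n → X) :
    BddAbove (Set.range fun i => ∫ x, G i x ∂μ - ∑ j, (1 / (n : ℝ)) * G i (u j)) :=
  ⟨c, Set.forall_mem_range.2 fun i => (abs_le.1 (abs_integral_sub_empirical_le μ hG hn u i)).2⟩

theorem abs_uniformDeviation_update_sub_le [Nonempty ι] (hG : ∀ i x, G i x ∈ Set.Icc 0 c)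
    (hn : 0 < n)
    (u : Fin n → X) (k : Fin n) (x : X) :
    |uniformDeviation μ G (Function.update u k x) - uniformDeviation μ G u| ≤ c / n := by
  refine abs_ciSup_sub_ciSup_le (bddAbove_range_integral_sub_empirical μ hG hn _)
    (bddAbove_range_integral_sub_empirical μ hG hn _) fun i => ?_
  rw [sub_sub_sub_cancel_left, abs_sub_comm, sum_mul_update_sub (fun _ => 1 / (n : ℝ)) (G i),
    abs_mul, abs_of_nonneg (by positivity : 0 ≤ 1 / (n : ℝ)), one_div, inv_mul_eq_div]
  gcongr
  rw [abs_le]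
  constructor <;> linarith [(hG i x).1, (hG i x).2, (hG i (u k)).1, (hG i (u k)).2]

variable [TopologicalSpace X] [SecondCountableTopology X] [BorelSpace X]

theorem measurable_uniformDeviation (hcont : ∀ i, Continuous (G i))
    (hG : ∀ i x, G i x ∈ Set.Icc 0 c) (hn : 0 < n) :
    Measurable (uniformDeviation μ G : (Fin n → X) → ℝ) :=
  measurable_ciSup_of_continuous (fun i => by have := hcont i; fun_prop)
    fun i u => abs_integral_sub_empirical_le μ hG hn u i

theorem measurable_signedSup (hcont : ∀ i, Continuous (G i))
    (hG : ∀ i x, G i x ∈ Set.Icc 0 c) (σ : Fin n → ℤˣ) : Measurable (signedSup G σ) :=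
  measurable_ciSup_of_continuous (fun i => by have := hcont i; fun_prop)
    fun i u => abs_sum_units_mul_le hG σ u i

/-- Symmetrization: a ghost sample replaces the expectations, and exchanging the two samples in the
coordinates with negative sign preserves their joint law. -/
theorem integral_uniformDeviation_le [Nonempty ι] (hcont : ∀ i, Continuous (G i))
    (hG : ∀ i x, G i x ∈ Set.Icc 0 c) (hn : 0 < n) :
    ∫ u, uniformDeviation μ G u ∂(Measure.pi fun _ : Fin n => μ) ≤
      2 * ∫ u : Fin n → X, rademacherComplexity (Set.range fun i j => G i (u j))
        ∂(Measure.pi fun _ => μ) := by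
  have hn' : (0 : ℝ) < n := Nat.cast_pos.2 hn
  set ν : Measure (Fin n → X) := Measure.pi fun _ => μ with hν
  set Q : Measure (Fin n → X × X) := Measure.pi fun _ => μ.prod μ with hQ
  have hGint : ∀ i, Integrable (G i) μ := fun i =>
    Integrable.of_bound (hcont i).measurable.aestronglyMeasurable c (ae_of_all _ fun x => by
      rw [Real.norm_eq_abs, abs_of_nonneg (hG i x).1]
      exact (hG i x).2)
  -- the deviation between the two halves of a double sample
  set d : ι → (Fin n → X × X) → ℝ := fun i w =>
    ∑ j, (1 / (n : ℝ)) * (G i (w j).2 - G i (w j).1) with hd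
  have hdb : ∀ i w, |d i w| ≤ c := fun i w => by
    calc |d i w| ≤ ∑ j, |(1 / (n : ℝ)) * (G i (w j).2 - G i (w j).1)| :=
          Finset.abs_sum_le_sum_abs _ _
      _ ≤ ∑ _j : Fin n, (1 / (n : ℝ)) * c := Finset.sum_le_sum fun j _ => by
          rw [abs_mul, abs_of_nonneg (by positivity : 0 ≤ 1 / (n : ℝ))]
          gcongr
          rw [abs_le]
          constructor <;> linarith [(hG i (w j).1).1, (hG i (w j).1).2, (hG i (w j).2).1,
            (hG i (w j).2).2]
      _ = c := by
          rw [Finset.sum_const, Finset.card_univ, Fintype.card_fin, nsmul_eq_mul]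
          field_simp
  have hdbdd : ∀ w, BddAbove (Set.range fun i => d i w) := fun w =>
    ⟨c, Set.forall_mem_range.2 fun i => (abs_le.1 (hdb i w)).2⟩
  set Ψ : (Fin n → X × X) → ℝ := fun w => ⨆ i, d i w with hΨ
  have hΨm : Measurable Ψ := measurable_ciSup_of_continuous (fun i => by
    have := hcont i
    simp only [hd]
    fun_prop) hdb
  have hΨb : ∀ w, |Ψ w| ≤ c := fun w => abs_ciSup_le fun i => hdb i w
  have hint : ∀ {Y : Type _} [MeasurableSpace Y] (m : Measure Y) [IsFiniteMeasure m]
      (h : Y → ℝ) (b : ℝ), Measurable h → (∀ y, |h y| ≤ b) → Integrable h m :=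
    fun m _ h b hm hb => Integrable.of_bound hm.aestronglyMeasurable b (ae_of_all _ hb)
  have hmp : MeasurePreserving (MeasurableEquiv.arrowProdEquivProdArrow X X (Fin n)) Q
      (ν.prod ν) := measurePreserving_arrowProdEquivProdArrow X X (Fin n) _ _
  have hzip : Measurable fun q : (Fin n → X) × (Fin n → X) => fun j => (q.1 j, q.2 j) := by
    fun_prop
  -- Jensen's inequality for the supremum
  have hghost : ∀ u, uniformDeviation μ G u ≤ ∫ u', Ψ (fun j => (u j, u' j)) ∂ν := by
    intro u
    refine ciSup_le fun i => ?_
    have heval : ∀ j : Fin n, ∫ u' : Fin n → X, G i (u' j) ∂ν = ∫ x, G i x ∂μ := fun j =>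
      integral_comp_eval (i := j) (μ := fun _ => μ)
        (hcont i).measurable.aestronglyMeasurable
    have hevalint : ∀ j : Fin n, Integrable (fun u' : Fin n → X => G i (u' j)) ν := fun j =>
      integrable_comp_eval (i := j) (μ := fun _ => μ) (hGint i)
    have h1 : ∫ u' : Fin n → X, d i (fun j => (u j, u' j)) ∂ν =
        ∫ x, G i x ∂μ - ∑ j, (1 / (n : ℝ)) * G i (u j) := by
      simp only [hd]
      have hterm : ∀ j : Fin n,
          Integrable (fun u' : Fin n → X => (1 / (n : ℝ)) * (G i (u' j) - G i (u j))) ν :=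
        fun j => ((hevalint j).sub (integrable_const _)).const_mul _
      rw [integral_finsetSum _ fun j _ => hterm j]
      simp only [integral_const_mul]
      have h2 : ∀ j : Fin n, ∫ u' : Fin n → X, (G i (u' j) - G i (u j)) ∂ν =
          ∫ x, G i x ∂μ - G i (u j) := fun j => by
        rw [integral_sub (hevalint j) (integrable_const _), heval]
        simp
      simp only [h2, mul_sub, Finset.sum_sub_distrib]
      rw [Finset.sum_const, Finset.card_univ, Fintype.card_fin, nsmul_eq_mul]
      congr 1
      field_simp
    rw [← h1]
    refine integral_mono ?_ ?_ fun u' => le_ciSup (hdbdd _) i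
    · refine hint ν _ c ?_ fun u' => hdb i _
      have := (hcont i).measurable
      simp only [hd]
      fun_prop
    · exact hint ν _ c (hΨm.comp (by fun_prop)) fun u' => hΨb _
  have hdouble : ∫ u, uniformDeviation μ G u ∂ν ≤ ∫ w, Ψ w ∂Q := by
    have hΨint : Integrable (fun q : (Fin n → X) × (Fin n → X) => Ψ fun j => (q.1 j, q.2 j))
        (ν.prod ν) := hint _ _ c (hΨm.comp hzip) fun q => hΨb _
    calc ∫ u, uniformDeviation μ G u ∂ν ≤ ∫ u, ∫ u', Ψ (fun j => (u j, u' j)) ∂ν ∂ν :=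
          integral_mono (hint ν _ c (measurable_uniformDeviation μ hcont hG hn)
            (abs_uniformDeviation_le μ hG hn)) hΨint.integral_prod_left hghost
      _ = ∫ q, Ψ (fun j => (q.1 j, q.2 j)) ∂(ν.prod ν) := (integral_prod _ hΨint).symm
      _ = ∫ w, Ψ w ∂Q := by
          rw [← hmp.integral_comp']
          rfl
  have hSint : ∀ σ : Fin n → ℤˣ, Integrable (signedSup G σ) ν := fun σ =>
    hint ν _ (n * c) (measurable_signedSup hcont hG σ) (abs_signedSup_le hG σ)
  have hfst : MeasurePreserving (fun (w : Fin n → X × X) j => (w j).1) Q ν :=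
    measurePreserving_pi (fun _ => μ.prod μ) (fun _ => μ) fun _ => measurePreserving_fst
  have hsnd : MeasurePreserving (fun (w : Fin n → X × X) j => (w j).2) Q ν :=
    measurePreserving_pi (fun _ => μ.prod μ) (fun _ => μ) fun _ => measurePreserving_snd
  have hsign : ∀ σ : Fin n → ℤˣ, ∫ w, Ψ w ∂Q ≤
      (1 / (n : ℝ)) * (∫ u, signedSup G σ u ∂ν + ∫ u, signedSup G (-σ) u ∂ν) := by
    intro σ
    set τ : Fin n → X × X → X × X := fun j => if σ j = 1 then id else Prod.swap with hτ
    have hτmp : MeasurePreserving (fun (w : Fin n → X × X) j => τ j (w j)) Q Q := by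
      refine measurePreserving_pi (fun _ => μ.prod μ) (fun _ => μ.prod μ) fun j => ?_
      simp only [hτ]
      split_ifs
      · exact MeasurePreserving.id _
      · exact Measure.measurePreserving_swap
    have hpt : ∀ w : Fin n → X × X, Ψ (fun j => τ j (w j)) ≤
        (1 / (n : ℝ)) * (signedSup G σ (fun j => (w j).2) + signedSup G (-σ) fun j => (w j).1) := by
      intro w
      refine ciSup_le fun i => ?_
      have h1 : d i (fun j => τ j (w j)) = (1 / (n : ℝ)) *
          (∑ j, ((σ j : ℤ) : ℝ) * G i (w j).2 + ∑ j, (((-σ) j : ℤ) : ℝ) * G i (w j).1) := by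
        rw [← Finset.sum_add_distrib, Finset.mul_sum]
        refine Finset.sum_congr rfl fun j _ => ?_
        rcases Int.units_eq_one_or (σ j) with h | h
        · simp [hτ, h, sub_eq_add_neg]
        · have h' : ¬ ((-1 : ℤˣ) = 1) := by decide
          simp [hτ, h, h', sub_eq_add_neg, add_comm]
      rw [h1]
      gcongr
      · exact le_signedSup hG σ (fun j => (w j).2) i
      · exact le_signedSup hG (-σ) (fun j => (w j).1) i
    have hi1 : Integrable (fun w : Fin n → X × X => signedSup G σ fun j => (w j).2) Q :=
      hsnd.integrable_comp_of_integrable (hSint σ)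
    have hi2 : Integrable (fun w : Fin n → X × X => signedSup G (-σ) fun j => (w j).1) Q :=
      hfst.integrable_comp_of_integrable (hSint (-σ))
    have hcomp : ∀ {Y Z : Type _} [MeasurableSpace Y] [MeasurableSpace Z] {m : Measure Y}
        {m' : Measure Z} {φ : Y → Z} (_ : MeasurePreserving φ m m') {h : Z → ℝ},
        Measurable h → ∫ y, h (φ y) ∂m = ∫ z, h z ∂m' := fun hφ h hh => by
      rw [← hφ.map_eq, integral_map hφ.measurable.aemeasurable hh.aestronglyMeasurable]
    calc ∫ w, Ψ w ∂Q = ∫ w, Ψ (fun j => τ j (w j)) ∂Q := (hcomp hτmp hΨm).symm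
      _ ≤ ∫ w : Fin n → X × X, (1 / (n : ℝ)) *
          (signedSup G σ (fun j => (w j).2) + signedSup G (-σ) fun j => (w j).1) ∂Q :=
          integral_mono (hint Q _ c (hΨm.comp hτmp.measurable) fun w => hΨb _)
            ((hi1.add hi2).const_mul _) hpt
      _ = _ := by
          rw [integral_const_mul, integral_add hi1 hi2,
            hcomp hsnd (measurable_signedSup hcont hG σ),
            hcomp hfst (measurable_signedSup hcont hG (-σ))]
  have hneg : ∑ σ : Fin n → ℤˣ, ∫ u, signedSup G (-σ) u ∂ν =
      ∑ σ : Fin n → ℤˣ, ∫ u, signedSup G σ u ∂ν :=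
    Fintype.sum_equiv (Equiv.neg _) _ _ fun σ => rfl
  have hsum : (2 : ℝ) ^ n * ∫ w, Ψ w ∂Q ≤
      (1 / (n : ℝ)) * (2 * ∑ σ : Fin n → ℤˣ, ∫ u, signedSup G σ u ∂ν) := by
    have h := Finset.sum_le_sum fun (σ : Fin n → ℤˣ) (_ : σ ∈ Finset.univ) => hsign σ
    rw [Finset.sum_const, Finset.card_univ, nsmul_eq_mul, ← Finset.mul_sum,
      Finset.sum_add_distrib, hneg] at h
    have hcard : (Fintype.card (Fin n → ℤˣ) : ℝ) = 2 ^ n := by simp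
    rw [hcard] at h
    linarith
  simp only [rademacherComplexity_range]
  rw [integral_const_mul, integral_const_mul, integral_finsetSum _ fun σ _ => hSint σ]
  refine hdouble.trans ?_
  have h2 : (0 : ℝ) < 2 ^ n := by positivity
  rw [← mul_le_mul_iff_right₀ h2]
  refine hsum.trans (le_of_eq ?_)
  field_simp

/-- With probability at least `1 - δ` all expectations exceed their empirical means by at most twice
the empirical Rademacher complexity and a deviation term. -/
theorem exists_measurableSet_integral_le_rademacher [Nonempty ι]
    (hcont : ∀ i, Continuous (G i))
    (hG : ∀ i x, G i x ∈ Set.Icc 0 c) (hn : 0 < n) {δ : ℝ} (hδ : 0 < δ) (hδ1 : δ < 1) :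
    ∃ A : Set (Fin n → X), MeasurableSet A ∧
      ENNReal.ofReal (1 - δ) ≤ (Measure.pi fun _ : Fin n => μ) A ∧
      ∀ u ∈ A, ∀ i, ∫ x, G i x ∂μ ≤ ∑ j, (1 / (n : ℝ)) * G i (u j)
        + 2 * rademacherComplexity (Set.range fun i j => G i (u j))
        + 3 * c * Real.sqrt (2 * Real.log (4 / δ) / n) := by
  have hn' : (0 : ℝ) < n := Nat.cast_pos.2 hn
  set ν : Measure (Fin n → X) := Measure.pi fun _ => μ with hν
  have hX : Nonempty X := nonempty_of_isProbabilityMeasure μ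
  have hc : 0 ≤ c := by
    obtain ⟨i⟩ := ‹Nonempty ι›
    obtain ⟨x⟩ := hX
    exact (hG i x).1.trans (hG i x).2
  rcases hc.eq_or_lt with rfl | hc
  · -- all functions vanish
    have h0 : ∀ i x, G i x = 0 := fun i x => le_antisymm (hG i x).2 (hG i x).1
    refine ⟨Set.univ, MeasurableSet.univ, ?_, fun u _ i => ?_⟩
    · rw [measure_univ]
      exact ENNReal.ofReal_le_one.2 (by linarith)
    · simp [h0, rademacherComplexity]
  have hlog : 0 < Real.log (4 / δ) := Real.log_pos (by rw [lt_div_iff₀ hδ]; linarith)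
  set Rad : (Fin n → X) → ℝ := fun u =>
    rademacherComplexity (Set.range fun i j => G i (u j)) with hRad
  have hRadm : Measurable Rad := by
    simp only [hRad, rademacherComplexity_range]
    exact ((Finset.measurable_fun_sum _ fun σ _ =>
      measurable_signedSup hcont hG σ).const_mul _).const_mul _
  have hRadb : ∀ u, |Rad u| ≤ c := fun u => by
    simp only [hRad, rademacherComplexity_range]
    refine (abs_rademacherComplexity_le (abs_signedSup_le hG · u)).trans (le_of_eq ?_)
    field_simp
  have hRadd : ∀ u k x, |Rad (Function.update u k x) - Rad u| ≤ c / n := fun u k x => by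
    simp only [hRad, rademacherComplexity_range]
    rw [← mul_sub, ← mul_sub, ← Finset.sum_sub_distrib]
    exact abs_rademacherComplexity_le (abs_signedSup_update_sub_le hG · u k x)
  set f : (Fin n → X) → ℝ := fun u => uniformDeviation μ G u - 2 * Rad u with hf
  have hDm := measurable_uniformDeviation (n := n) μ hcont hG hn
  have hfm : Measurable f := hDm.sub (hRadm.const_mul 2)
  have hfb : ∀ u, |f u| ≤ 3 * c := fun u => by
    have h1 := abs_le.1 (abs_uniformDeviation_le μ hG hn u)
    have h2 := abs_le.1 (hRadb u)
    rw [abs_le]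
    constructor <;> simp only [hf] <;> linarith [h1.1, h1.2, h2.1, h2.2]
  have hfd : ∀ u k x, |f (Function.update u k x) - f u| ≤ 3 * (c / n) := fun u k x => by
    have h1 := abs_le.1 (abs_uniformDeviation_update_sub_le μ hG hn u k x)
    have h2 := abs_le.1 (hRadd u k x)
    rw [abs_le]
    constructor <;> simp only [hf] <;> linarith [h1.1, h1.2, h2.1, h2.2]
  have hmean : ∫ u, f u ∂ν ≤ 0 := by
    have hi1 : Integrable (uniformDeviation μ G) ν :=
      Integrable.of_bound hDm.aestronglyMeasurable c
        (ae_of_all _ (abs_uniformDeviation_le μ hG hn))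
    have hi2 : Integrable Rad ν :=
      Integrable.of_bound hRadm.aestronglyMeasurable c (ae_of_all _ hRadb)
    simp only [hf]
    rw [integral_sub hi1 (hi2.const_mul 2), integral_const_mul]
    linarith [integral_uniformDeviation_le μ hcont hG hn]
  set s : ℝ := Real.sqrt (2 * Real.log (4 / δ) / n) with hs
  have hs2 : s ^ 2 = 2 * Real.log (4 / δ) / n := Real.sq_sqrt (by positivity)
  have hε : 0 ≤ 3 * c * s := by positivity
  have htail := measureReal_ge_le_of_boundedDifferences μ (by positivity : 0 < 3 * (c / n)) f hfm
    hfb hfd hε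
  have hexp : Real.exp (-(3 * c * s) ^ 2 / (2 * (n * (3 * (c / n)) ^ 2))) = δ / 4 := by
    have h1 : -(3 * c * s) ^ 2 / (2 * (n * (3 * (c / n)) ^ 2)) = -Real.log (4 / δ) := by
      rw [mul_pow, hs2]
      field_simp
    rw [h1, ← Real.log_inv, inv_div, Real.exp_log (by positivity)]
  rw [hexp] at htail
  have hAm : MeasurableSet {u | 3 * c * s ≤ f u - ∫ v, f v ∂ν} :=
    measurableSet_le measurable_const (hfm.sub measurable_const)
  refine ⟨{u | 3 * c * s ≤ f u - ∫ v, f v ∂ν}ᶜ, hAm.compl, ?_, fun u hu i => ?_⟩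
  · rw [← ENNReal.ofReal_toReal (measure_ne_top ν _)]
    refine ENNReal.ofReal_le_ofReal ?_
    change _ ≤ ν.real _
    rw [probReal_compl_eq_one_sub hAm]
    linarith
  · have h1 : f u - ∫ v, f v ∂ν < 3 * c * s := not_le.1 hu
    have h2 : ∫ x, G i x ∂μ - ∑ j, (1 / (n : ℝ)) * G i (u j) ≤ uniformDeviation μ G u :=
      le_ciSup (bddAbove_range_integral_sub_empirical μ hG hn u) i
    simp only [hf] at h1
    linarith

end Deviation

end Rademacher

/-! ### The gradient loss on a domain with the cone condition -/

section Domain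

variable {M : ℕ} {p : ℝ} {Ω : Set (PhaseVec M)}

/-- A cone of height `ρ` is star-shaped about its vertex and contains a ball centred on its axis at
distance `ρ / 2`, whose radius depends only on the height and the opening angle. -/
theorem ConeCondition.exists_visible_ball (h : ConeCondition Ω) :
    ∃ r R : ℝ, 0 < r ∧ 2 * r ≤ R ∧ ∀ x ∈ Ω, ∃ w : PhaseVec M, ∀ y ∈ Metric.ball w r,
      ‖y - x‖ ≤ R ∧ segment ℝ x y ⊆ Ω := by
  obtain ⟨ρ, θ, hρ, hθ, hθ', hcone⟩ := h
  have hcos0 : 0 ≤ Real.cos θ :=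
    Real.cos_nonneg_of_neg_pi_div_two_le_of_le (by linarith) hθ'
  have hcos1 : Real.cos θ < 1 := by
    have := Real.cos_lt_cos_of_nonneg_of_le_pi_div_two le_rfl hθ' hθ
    rwa [Real.cos_zero] at this
  refine ⟨ρ / 4 * (1 - Real.cos θ), ρ, mul_pos (by positivity) (by linarith), by nlinarith,
    fun x hx => ?_⟩
  obtain ⟨v, hv, hsub⟩ := hcone x hx
  refine ⟨x + (ρ / 2) • v, fun y hy => ?_⟩
  set e : PhaseVec M := y - (x + (ρ / 2) • v) with he
  have hen : ‖e‖ < ρ / 4 * (1 - Real.cos θ) := by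
    rwa [Metric.mem_ball, dist_eq_norm] at hy
  have hyx : y - x = (ρ / 2) • v + e := by
    rw [he]
    abel
  have hnorm : ‖y - x‖ ≤ ρ / 2 + ‖e‖ := by
    rw [hyx]
    refine (norm_add_le _ _).trans ?_
    rw [norm_smul, hv, mul_one, Real.norm_of_nonneg (by positivity)]
  have hinner : ρ / 2 - ‖e‖ ≤ inner ℝ v (y - x) := by
    rw [hyx, inner_add_right, inner_smul_right, real_inner_self_eq_norm_sq, hv]
    have h1 := abs_le.1 (abs_real_inner_le_norm v e)
    rw [hv, one_mul] at h1
    linarith [h1.1]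
  have hle : ‖y - x‖ ≤ ρ := by nlinarith
  refine ⟨hle, fun z hz => hsub ?_⟩
  rw [segment_eq_image'] at hz
  obtain ⟨t, ⟨ht0, ht1⟩, rfl⟩ := hz
  have hmem : ‖y - x‖ * Real.cos θ ≤ inner ℝ v (y - x) := by
    refine le_trans ?_ hinner
    have := mul_le_mul_of_nonneg_right hnorm hcos0
    nlinarith [norm_nonneg e]
  simp only [finiteCone, Set.mem_ofPred_eq, add_sub_cancel_left, norm_smul, inner_smul_right,
    Real.norm_of_nonneg ht0]
  refine ⟨(mul_le_of_le_one_left (norm_nonneg _) ht1).trans hle, ?_⟩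
  rw [mul_assoc]
  exact mul_le_mul_of_nonneg_left hmem ht0

theorem gradLoss_nonneg (p : ℝ) (H K : PhaseVec M → ℝ) (u : PhaseVec M) : 0 ≤ gradLoss p H K u :=
  Finset.sum_nonneg fun _ _ => Real.rpow_nonneg (abs_nonneg _) _

theorem gradLoss_add_const (p : ℝ) (H K : PhaseVec M → ℝ) (a : ℝ) :
    gradLoss p (fun u => H u + a) K = gradLoss p H K := by
  funext u
  simp only [gradLoss, gradient, fderiv_add_const]

/-- The `p`-th power of the operator norm of `D(H - K)` is at most a dimensional constant times the
loss, by the equivalence of the Euclidean and the `p`-norm. -/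
theorem norm_fderiv_sub_rpow_le (hp : 1 ≤ p) {H K : PhaseVec M → ℝ} {u : PhaseVec M}
    (hH : DifferentiableAt ℝ H u) (hK : DifferentiableAt ℝ K u) :
    ‖fderiv ℝ (fun x => H x - K x) u‖ ^ p ≤
      ((2 * M : ℕ) : ℝ) ^ (p - 1) * gradLoss p H K u := by
  set w : PhaseVec M := gradient H u - gradient K u with hw
  have h1 : ‖fderiv ℝ (fun x => H x - K x) u‖ = ‖w‖ := by
    rw [fderiv_fun_sub hH hK, hw, gradient, gradient, ← map_sub, LinearIsometryEquiv.norm_map]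
  have h2 : ‖w‖ ≤ ∑ i, |w i| := by
    conv_lhs => rw [← (EuclideanSpace.basisFun (Fin (2 * M)) ℝ).sum_repr w]
    refine (norm_sum_le _ _).trans (Finset.sum_le_sum fun i _ => ?_)
    rw [norm_smul, OrthonormalBasis.norm_eq_one, mul_one]
    simp
  rw [h1]
  calc ‖w‖ ^ p ≤ (∑ i, |w i|) ^ p := by gcongr
    _ ≤ _ := by
      have h := Real.rpow_sum_le_const_mul_sum_rpow Finset.univ (fun i => w i) hp
      rw [Finset.card_univ, Fintype.card_fin] at h
      exact h

theorem MemS1p.continuousOn_gradient {H : PhaseVec M → ℝ} (hΩ : IsOpen Ω) (hH : MemS1p p Ω H) :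
    ContinuousOn (gradient H) Ω :=
  (InnerProductSpace.toDual ℝ (PhaseVec M)).symm.continuous.comp_continuousOn
    (hH.contDiffOn.continuousOn_fderiv_of_isOpen hΩ le_rfl)

theorem MemS1p.continuousOn_gradLoss (hp : 0 ≤ p) (hΩ : IsOpen Ω) {H K : PhaseVec M → ℝ}
    (hH : MemS1p p Ω H) (hK : MemS1p p Ω K) : ContinuousOn (gradLoss p H K) Ω := by
  unfold gradLoss
  refine continuousOn_finsetSum _ fun i _ => ContinuousOn.rpow_const ?_ fun _ _ => Or.inr hp
  have h : ∀ {L : PhaseVec M → ℝ}, MemS1p p Ω L → ContinuousOn (fun u => gradient L u i) Ω :=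
    fun hL => (EuclideanSpace.proj (𝕜 := ℝ) i).continuous.comp_continuousOn
      (hL.continuousOn_gradient hΩ)
  exact ((h hH).sub (h hK)).abs

theorem MemS1p.integrable_gradLoss (hp : 0 < p) {H K : PhaseVec M → ℝ} (hH : MemS1p p Ω H)
    (hK : MemS1p p Ω K) : Integrable (gradLoss p H K) (volume.restrict Ω) := by
  unfold gradLoss
  refine integrable_finsetSum _ fun i _ => ?_
  have h : ∀ {L : PhaseVec M → ℝ}, MemS1p p Ω L →
      MemLp (fun u => gradient L u i) (ENNReal.ofReal p) (volume.restrict Ω) := fun hL =>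
    (EuclideanSpace.proj (𝕜 := ℝ) i : PhaseVec M →L[ℝ] ℝ).comp_memLp' hL.memLp_gradient
  have h1 := ((h hH).sub (h hK)).integrable_norm_rpow (by simpa using hp) ENNReal.ofReal_ne_top
  rw [ENNReal.toReal_ofReal hp.le] at h1
  exact h1

theorem MemS1p.integrable_abs_sub_rpow (hp : 0 < p) {H K : PhaseVec M → ℝ} (hH : MemS1p p Ω H)
    (hK : MemS1p p Ω K) : Integrable (fun u => |H u - K u| ^ p) (volume.restrict Ω) := by
  have h1 := (hH.memLp.sub hK.memLp).integrable_norm_rpow (by simpa using hp)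
    ENNReal.ofReal_ne_top
  rw [ENNReal.toReal_ofReal hp.le] at h1
  exact h1

theorem MemS1p.integrable (hp : 1 ≤ p) (hbdd : Bornology.IsBounded Ω) {H : PhaseVec M → ℝ}
    (hH : MemS1p p Ω H) : Integrable H (volume.restrict Ω) := by
  have : IsFiniteMeasure (volume.restrict Ω) := ⟨by simpa using hbdd.measure_lt_top⟩
  exact hH.memLp.integrable (by simpa using hp)

theorem MemS1p.add_const (hbdd : Bornology.IsBounded Ω) {H : PhaseVec M → ℝ} (hH : MemS1p p Ω H)
    (a : ℝ) : MemS1p p Ω (fun u => H u + a) := by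
  have : IsFiniteMeasure (volume.restrict Ω) := ⟨by simpa using hbdd.measure_lt_top⟩
  refine ⟨hH.contDiffOn.add contDiffOn_const, hH.memLp.add (memLp_const a), ?_⟩
  have h : gradient (fun u => H u + a) = gradient H := by
    funext u
    simp only [gradient, fderiv_add_const]
  rw [h]
  exact hH.memLp_gradient

theorem sobolevSeminorm_sub_le (hp : 1 ≤ p) (hΩ : IsOpen Ω) {H K : PhaseVec M → ℝ}
    (hH : MemS1p p Ω H) (hK : MemS1p p Ω K) :
    sobolevSeminorm p Ω volume (fun x => H x - K x) ≤ ENNReal.ofReal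
      ((((2 * M : ℕ) : ℝ) ^ (p - 1) * ∫ u in Ω, gradLoss p H K u) ^ (1 / p)) := by
  have hp0 : 0 < p := by linarith
  have hJ : 0 ≤ ∫ u in Ω, gradLoss p H K u := integral_nonneg fun u => gradLoss_nonneg p H K u
  rw [sobolevSeminorm, ← ENNReal.ofReal_rpow_of_nonneg (by positivity) (by positivity)]
  gcongr
  rw [← integral_const_mul, ofReal_integral_eq_lintegral_ofReal
    ((hH.integrable_gradLoss hp0 hK).const_mul _)
    (ae_of_all _ fun u => mul_nonneg (by positivity) (gradLoss_nonneg p H K u))]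
  refine setLIntegral_mono' hΩ.measurableSet fun u hu => ?_
  rw [← ofReal_norm, ENNReal.ofReal_rpow_of_nonneg (norm_nonneg _) hp0.le]
  have hdiff : ∀ {L : PhaseVec M → ℝ}, MemS1p p Ω L → DifferentiableAt ℝ L u := fun hL =>
    (hL.contDiffOn.contDiffAt (hΩ.mem_nhds hu)).differentiableAt one_ne_zero
  exact ENNReal.ofReal_le_ofReal (norm_fderiv_sub_rpow_le hp (hdiff hH) (hdiff hK))

/-- A function of mean zero is bounded by its oscillation, so the oscillation estimate controls the
pointwise error of two functions with equal integrals. -/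
theorem exists_abs_sub_rpow_le_integral_gradLoss (hM : 0 < M) (hp : 2 * (M : ℝ) < p)
    (hΩ : IsOpen Ω) (hconn : IsConnected Ω) (hbdd : Bornology.IsBounded Ω)
    (hcone : ConeCondition Ω) :
    ∃ D : ℝ, 0 < D ∧ ∀ H K : PhaseVec M → ℝ, MemS1p p Ω H → MemS1p p Ω K →
      ∫ u in Ω, H u = ∫ u in Ω, K u →
        ∀ x ∈ Ω, |H x - K x| ^ p ≤ D * ∫ u in Ω, gradLoss p H K u := by
  have hM1 : (1 : ℝ) ≤ M := Nat.one_le_cast.2 hM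
  have hp1 : 1 < p := by linarith
  have hp0 : 0 < p := by linarith
  obtain ⟨r, R, hr, hrR, hvis⟩ := hcone.exists_visible_ball
  obtain ⟨C, hC⟩ := exists_enorm_sub_le_sobolevSeminorm (volume : Measure (PhaseVec M)) hp1
    (by rw [finrank_euclideanSpace_fin]; push_cast; exact hp) hΩ hconn hbdd hr hrR hvis
  set q : ℝ := ((2 * M : ℕ) : ℝ) ^ (p - 1) with hq
  have hq0 : 0 ≤ q := by positivity
  refine ⟨(C : ℝ) ^ p * q + 1, by positivity, fun H K hH hK hHK x hx => ?_⟩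
  set J : ℝ := ∫ u in Ω, gradLoss p H K u with hJ
  have hJ0 : 0 ≤ J := integral_nonneg fun u => gradLoss_nonneg p H K u
  set B : ℝ := C * (q * J) ^ (1 / p) with hB
  have hosc : ∀ z ∈ Ω, |(H x - K x) - (H z - K z)| ≤ B := fun z hz => by
    have h := (hC (fun x => H x - K x) (hH.contDiffOn.sub hK.contDiffOn) x hx z hz).trans
      (mul_le_mul_right (sobolevSeminorm_sub_le hp1.le hΩ hH hK) _)
    rw [← ofReal_norm, ← ENNReal.ofReal_coe_nnreal, ← ENNReal.ofReal_mul C.coe_nonneg,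
      ENNReal.ofReal_le_ofReal_iff (by positivity)] at h
    exact h
  have hfin : volume Ω < ⊤ := hbdd.measure_lt_top
  have : IsFiniteMeasure (volume.restrict Ω) := ⟨by simpa using hfin⟩
  have hvol : 0 < volume.real Ω :=
    ENNReal.toReal_pos (hΩ.measure_pos volume hconn.nonempty).ne' hfin.ne
  have hHi := hH.integrable hp1.le hbdd
  have hKi := hK.integrable hp1.le hbdd
  have hmean : ∫ z in Ω, ((H x - K x) - (H z - K z)) = volume.real Ω * (H x - K x) := by
    have hsub : Integrable (fun z => H z - K z) (volume.restrict Ω) := hHi.sub hKi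
    rw [integral_sub (integrable_const _) hsub, integral_sub hHi hKi, hHK, sub_self,
      sub_zero, integral_const, smul_eq_mul, measureReal_restrict_apply_univ]
  have habs : |H x - K x| ≤ B := by
    have h := norm_setIntegral_le_of_norm_le_const
      (f := fun z => (H x - K x) - (H z - K z)) hfin hosc
    rw [hmean, norm_mul, Real.norm_of_nonneg hvol.le, mul_comm] at h
    exact le_of_mul_le_mul_right h hvol
  calc |H x - K x| ^ p ≤ B ^ p := by gcongr
    _ = (C : ℝ) ^ p * q * J := by
      rw [hB, Real.mul_rpow C.coe_nonneg (by positivity), ← Real.rpow_mul (by positivity),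
        one_div_mul_cancel hp0.ne', Real.rpow_one, mul_assoc]
    _ ≤ ((C : ℝ) ^ p * q + 1) * J := by gcongr; linarith

/-- A lower bound of the density turns integrals over the domain into expectations. -/
theorem sInf_mul_setIntegral_le_integral (hΩ : MeasurableSet Ω) {f : PhaseVec M → ℝ}
    {P : Measure (PhaseVec M)}
    (hP : P = (volume.restrict Ω).withDensity fun u => ENNReal.ofReal (f u))
    (hinf : 0 < sInf (f '' Ω)) {g : PhaseVec M → ℝ} (hg : ∀ u, 0 ≤ g u) (hgi : Integrable g P) :
    sInf (f '' Ω) * ∫ u in Ω, g u ≤ ∫ u, g u ∂P := by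
  -- the infimum of a set that is not bounded below is the junk value `0`
  have hbdd : BddBelow (f '' Ω) := by
    by_contra h
    rw [Real.sInf_of_not_bddBelow h] at hinf
    exact lt_irrefl _ hinf
  have hle : ENNReal.ofReal (sInf (f '' Ω)) • volume.restrict Ω ≤ P := by
    rw [hP, ← withDensity_const]
    refine withDensity_mono ?_
    filter_upwards [ae_restrict_mem hΩ] with u hu
    exact ENNReal.ofReal_le_ofReal (csInf_le hbdd ⟨u, hu, rfl⟩)
  have h := integral_mono_measure hle (ae_of_all _ hg) hgi
  rwa [integral_smul_measure, ENNReal.toReal_ofReal hinf.le, smul_eq_mul] at h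

/-- The uniform deviation bound for the gradient losses. The losses are continuous only on `Ω`, so
the probability measure is first regarded as one on the subtype. -/
theorem exists_measurableSet_integral_gradLoss_le (hp : 0 ≤ p) (hΩ : IsOpen Ω)
    {H : PhaseVec M → ℝ} {F : Set (PhaseVec M → ℝ)} {c : ℝ} {P : Measure (PhaseVec M)}
    [IsProbabilityMeasure P] (hP : P Ωᶜ = 0) {n : ℕ} (hn : 0 < n) {δ : ℝ} (hδ : 0 < δ)
    (hH : MemS1p p Ω H) (hF : ∀ K ∈ F, MemS1p p Ω K)
    (hc : ∀ K ∈ F, ∀ u ∈ Ω, gradLoss p H K u ≤ c) :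
    ∃ A : Set (Fin n → PhaseVec M), MeasurableSet A ∧
      ENNReal.ofReal (1 - δ) ≤ Measure.pi (fun _ : Fin n => P) A ∧
      ∀ u ∈ A, ∀ K ∈ F, ∫ x, gradLoss p H K x ∂P ≤ empiricalLoss p H K u
        + 2 * rademacherComplexity (lossClass p H F u)
        + 3 * c * Real.sqrt (2 * Real.log (4 / δ) / n) := by
  rcases le_or_gt 1 δ with hδ1 | hδ1
  · exact ⟨∅, MeasurableSet.empty, by simp [hδ1], fun u hu => absurd hu (Set.notMem_empty u)⟩
  rcases F.eq_empty_or_nonempty with rfl | hne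
  · refine ⟨Set.univ, MeasurableSet.univ, ?_, fun u _ K hK => absurd hK (Set.notMem_empty K)⟩
    rw [measure_univ]
    exact ENNReal.ofReal_le_one.2 (by linarith)
  have : Nonempty F := hne.to_subtype
  have hval : MeasurableEmbedding (Subtype.val : Ω → PhaseVec M) :=
    MeasurableEmbedding.subtype_coe hΩ.measurableSet
  set μ : Measure Ω := P.comap Subtype.val with hμ
  have hmap : μ.map Subtype.val = P := by
    rw [hμ, map_comap_subtype_coe hΩ.measurableSet]
    exact Measure.restrict_eq_self_of_ae_mem (mem_ae_iff.2 hP)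
  have : IsProbabilityMeasure μ := by
    rw [← Measure.isProbabilityMeasure_map_iff hval.measurable.aemeasurable, hmap]
    infer_instance
  set G : F → Ω → ℝ := fun K x => gradLoss p H K x with hG
  obtain ⟨A, hA, hAδ, hAle⟩ := exists_measurableSet_integral_le_rademacher (n := n) μ (G := G)
    (c := c)
    (fun K => continuousOn_iff_continuous_domRestrict.1
      (hH.continuousOn_gradLoss hp hΩ (hF K K.2)))
    (fun K x => ⟨gradLoss_nonneg p H K x, hc K K.2 x x.2⟩) hn hδ hδ1
  set e : (Fin n → Ω) → (Fin n → PhaseVec M) := fun u i => u i with he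
  have hemb : MeasurableEmbedding e :=
    (Topology.IsOpenEmbedding.piMap fun _ : Fin n => hΩ.isOpenEmbedding_subtypeVal)
      |>.measurableEmbedding
  have hpi : Measure.pi (fun _ : Fin n => P) = (Measure.pi fun _ : Fin n => μ).map e := by
    have : ∀ _ : Fin n, SigmaFinite (μ.map (Subtype.val : Ω → PhaseVec M)) := fun _ => by
      rw [hmap]
      infer_instance
    have h := Measure.pi_map_pi (μ := fun _ : Fin n => μ)
      (f := fun _ => (Subtype.val : Ω → PhaseVec M)) fun _ => hval.measurable.aemeasurable
    simp only [hmap] at h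
    exact h.symm
  refine ⟨e '' A, hemb.measurableSet_image.2 hA, ?_, ?_⟩
  · rw [hpi, hemb.map_apply, Set.preimage_image_eq _ hemb.injective]
    exact hAδ
  · rintro _ ⟨u, hu, rfl⟩ K hK
    have h := hAle u hu ⟨K, hK⟩
    have hint : ∫ x, G ⟨K, hK⟩ x ∂μ = ∫ x, gradLoss p H K x ∂P := by
      rw [← hmap, hval.integral_map]
    have hclass : lossClass p H F (e u) = Set.range fun (i : F) j => G i (u j) := by
      ext v
      simp only [lossClass, Set.mem_ofPred_eq, Set.mem_range, Subtype.exists, hG, he]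
      exact ⟨fun ⟨K, hK, h⟩ => ⟨K, hK, h.symm⟩, fun ⟨K, hK, h⟩ => ⟨K, hK, h.symm⟩⟩
    rw [hint, ← Finset.mul_sum] at h
    rw [hclass]
    exact h

end Domain

/-! ### The uniform error estimate -/

theorem mainTheorem3 (M : ℕ) (hM : 0 < M) (p : ℝ) (hp : 2 * (M : ℝ) < p)
    (Ω : Set (PhaseVec M)) (hΩ_open : IsOpen Ω) (hΩ_conn : IsConnected Ω)
    (hΩ_bdd : Bornology.IsBounded Ω) (hΩ_cone : ConeCondition Ω) :
    -- the constants depend only on `M`, `p` and `Ω`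
    ∃ cP C : ℝ, 0 < cP ∧ 0 < C ∧
      -- zero-mean Poincaré inequality and its uniform (Morrey) version
      (∀ H K : PhaseVec M → ℝ, MemS1p p Ω H → MemS1p p Ω K →
        ∫ u in Ω, H u = ∫ u in Ω, K u →
          Integrable (gradLoss p H K) (volume.restrict Ω) ∧
          Integrable (fun u => |H u - K u| ^ p) (volume.restrict Ω) ∧
          ∫ u in Ω, |H u - K u| ^ p ≤ cP * ∫ u in Ω, gradLoss p H K u ∧
          BddAbove ((fun u => |H u - K u|) '' Ω) ∧
          supError Ω H K ^ p ≤ C ^ p * ∫ u in Ω, gradLoss p H K u) ∧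
      -- the estimate with high probability
      (∀ (H : PhaseVec M → ℝ) (F : Set (PhaseVec M → ℝ)) (c : ℝ)
          (P : Measure (PhaseVec M)) (f : PhaseVec M → ℝ) (n : ℕ) (δ : ℝ),
        MemS1p p Ω H → (∀ HNN ∈ F, MemS1p p Ω HNN) →
        (∀ HNN ∈ F, ∀ u ∈ Ω, gradLoss p H HNN u ≤ c) →
        IsProbabilityMeasure P → Measurable f →
        P = (volume.restrict Ω).withDensity (fun u => ENNReal.ofReal (f u)) →
        0 < sInf (f '' Ω) → 0 < n → 0 < δ →
        ∃ A : Set (Fin n → PhaseVec M), MeasurableSet A ∧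
          ENNReal.ofReal (1 - δ) ≤ Measure.pi (fun _ : Fin n => P) A ∧
          ∀ u ∈ A, ∀ HNN ∈ F, ∀ a : ℝ,
            -- `H + a` is the energy function with the same integral as `HNN`
            ∫ x in Ω, (H x + a) = ∫ x in Ω, HNN x →
              BddAbove ((fun x => |(H x + a) - HNN x|) '' Ω) ∧
              supError Ω (fun x => H x + a) HNN ^ p ≤
                C ^ p / sInf (f '' Ω) *
                  (empiricalLoss p H HNN u
                    + 2 * rademacherComplexity (lossClass p H F u)
                    + 3 * c * Real.sqrt (2 * Real.log (4 / δ) / n))) := by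
  have hM1 : (1 : ℝ) ≤ M := Nat.one_le_cast.2 hM
  have hp0 : 0 < p := by linarith
  have hfin : volume Ω < ⊤ := hΩ_bdd.measure_lt_top
  have hvol : 0 < volume.real Ω :=
    ENNReal.toReal_pos (hΩ_open.measure_pos volume hΩ_conn.nonempty).ne' hfin.ne
  obtain ⟨D, hD, hDle⟩ :=
    exists_abs_sub_rpow_le_integral_gradLoss hM hp hΩ_open hΩ_conn hΩ_bdd hΩ_cone
  have hCp : (D ^ (1 / p)) ^ p = D := by
    rw [← Real.rpow_mul hD.le, one_div_mul_cancel hp0.ne', Real.rpow_one]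
  -- with `C = D ^ (1 / p)` the pointwise estimate passes to the supremum
  have hsup : ∀ H K : PhaseVec M → ℝ, MemS1p p Ω H → MemS1p p Ω K →
      ∫ u in Ω, H u = ∫ u in Ω, K u →
        BddAbove ((fun u => |H u - K u|) '' Ω) ∧
        supError Ω H K ^ p ≤ D * ∫ u in Ω, gradLoss p H K u := by
    intro H K hH hK hHK
    have hJ : 0 ≤ ∫ u in Ω, gradLoss p H K u := integral_nonneg fun u => gradLoss_nonneg p H K u
    have hub : ∀ y ∈ (fun u => |H u - K u|) '' Ω,
        y ≤ (D * ∫ u in Ω, gradLoss p H K u) ^ (1 / p) := by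
      rintro _ ⟨x, hx, rfl⟩
      rw [one_div, Real.le_rpow_inv_iff_of_pos (abs_nonneg _) (by positivity) hp0]
      exact hDle H K hH hK hHK x hx
    refine ⟨⟨_, hub⟩, ?_⟩
    have h0 : 0 ≤ supError Ω H K := by
      refine Real.sSup_nonneg ?_
      rintro _ ⟨x, -, rfl⟩
      exact abs_nonneg _
    rw [← Real.le_rpow_inv_iff_of_pos h0 (by positivity) hp0, ← one_div]
    exact csSup_le (hΩ_conn.nonempty.image _) hub
  refine ⟨volume.real Ω * D, D ^ (1 / p), by positivity, by positivity, ?_, ?_⟩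
  · intro H K hH hK hHK
    obtain ⟨h1, h2⟩ := hsup H K hH hK hHK
    rw [hCp]
    refine ⟨hH.integrable_gradLoss hp0 hK, hH.integrable_abs_sub_rpow hp0 hK, ?_, h1, h2⟩
    have h := norm_setIntegral_le_of_norm_le_const (f := fun u => |H u - K u| ^ p) hfin
      fun x hx => by
        rw [Real.norm_of_nonneg (by positivity)]
        exact hDle H K hH hK hHK x hx
    calc ∫ u in Ω, |H u - K u| ^ p ≤ ‖∫ u in Ω, |H u - K u| ^ p‖ := le_abs_self _
      _ ≤ (D * ∫ u in Ω, gradLoss p H K u) * volume.real Ω := h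
      _ = _ := by ring
  · intro H F c P f n δ hH hF hc hPprob hf hP hinf hn hδ
    have hPΩ : P Ωᶜ = 0 := by
      rw [hP]
      refine withDensity_absolutelyContinuous _ _ ?_
      rw [Measure.restrict_apply hΩ_open.measurableSet.compl, Set.compl_inter_self, measure_empty]
    obtain ⟨A, hA, hAδ, hAle⟩ :=
      exists_measurableSet_integral_gradLoss_le hp0.le hΩ_open hPΩ hn hδ hH hF hc
    refine ⟨A, hA, hAδ, fun u hu K hK a ha => ?_⟩
    obtain ⟨h1, h2⟩ := hsup _ K (hH.add_const hΩ_bdd a) (hF K hK) ha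
    refine ⟨h1, h2.trans ?_⟩
    -- the loss does not see the additive constant
    rw [gradLoss_add_const, hCp, div_mul_eq_mul_div, le_div_iff₀ hinf, mul_assoc]
    gcongr
    refine le_trans ?_ (hAle u hu K hK)
    rw [mul_comm]
    have hPac : P ≪ volume.restrict Ω := by
      rw [hP]
      exact withDensity_absolutelyContinuous _ _
    have hi : Integrable (gradLoss p H K) P := by
      refine Integrable.of_bound
        ((hH.integrable_gradLoss hp0 (hF K hK)).aestronglyMeasurable.mono_ac hPac) c ?_
      filter_upwards [mem_ae_iff.2 hPΩ] with x hx
      rw [Real.norm_of_nonneg (gradLoss_nonneg p H K x)]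
      exact hc K hK x hx
    exact sInf_mul_setIntegral_le_integral hΩ_open.measurableSet hP hinf
      (gradLoss_nonneg p H K) hi
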